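/- Let $0<p<1$, $q=1-p$, $r=1/q$, $s>0$, $a>0$, and put $c_k=1$ for $k<0$ and $c_k=0$ for $k\ge 0$. Let $\{Z(u),\,u\ge 0\}$ be a real-valued L\'evy process whose characteristic function is, for all $u\ge0$ and $t\in\mathbb{R}$, \[E\,e^{itZ(u)}=\exp\Big\{u\sum_{k=-\infty}^{\infty}\big(e^{itsr^k}-1-itsr^kc_k\big)\,pq^k\Big\}.\] Let $U=\int_0^\infty e^{-au}\,dZ(u)$, where $\int_0^T e^{-au}\,dZ(u)$ is the limit in probability of the Riemann--Stieltjes sums over tagged partitions of $[0,T]$ as the mesh tends to $0$, and $\int_0^\infty$ is the limit in probability of $\int_0^T$ as $T\to\infty$. Then $U$ exists, and for all $t\in\mathbb{R}$ \[E\,e^{itU}=e^{g(t)/a},\qquad g(t)=itsq+\sum_{k=-\infty}^\infty\int_{sr^{k-1}}^{sr^k}q^k\big(e^{itx}-1-itxc_k\big)\frac{dx}{x},\] where the integrals and the series converge absolutely. Moreover, $g$ is a L\'evy--Khintchine exponent whose L\'evy measure has the density $q^k/x$ for $sr^{k-1}<x\le sr^k$, $k\in\mathbb{Z}$ (and $0$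 for $x\le 0$); consequently the distribution of $U$ is infinitely divisible, and its L\'evy measure has the density $q^k/(ax)$ for $sr^{k-1}<x\le sr^k$, $k\in\mathbb{Z}$ (and $0$ for $x\le0$). -/

import Mathlib

open MeasureTheory ProbabilityTheory Filter Topology
open scoped NNReal ENNReal

namespace StPetersburg

noncomputable section

/-- A real-valued Lévy process: starts at `0`, has independent and stationary increments, and is
continuous in probability. (No path regularity is required.) -/
structure IsLevyProcess {Ω : Type*} [MeasurableSpace Ω] (Z : ℝ≥0 → Ω → ℝ) (P : Measure Ω) :
    Prop where
  measurable : ∀ u, Measurable (Z u)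
  zero : ∀ᵐ ω ∂P, Z 0 ω = 0
  indep : HasIndepIncrements Z P
  stationary : ∀ u h, P.map (fun ω => Z (u + h) ω - Z u ω) = P.map (Z h)
  continuous : ∀ u, TendstoInMeasure P Z (𝓝 u) (Z u)

/-- A tagged partition `0 = pts 0 ≤ pts 1 ≤ ⋯ ≤ pts n = T` with tags `tags i ∈ [pts i, pts (i+1)]`
(the values of `pts` beyond `n` and of `tags` from `n` on are irrelevant). -/
structure TaggedPartition (T : ℝ≥0) where
  n : ℕ
  pts : ℕ → ℝ≥0
  tags : ℕ → ℝ≥0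
  pts_zero : pts 0 = 0
  pts_last : pts n = T
  pts_le : ∀ i < n, pts i ≤ pts (i + 1)
  tags_mem : ∀ i < n, tags i ∈ Set.Icc (pts i) (pts (i + 1))

/-- The mesh of the partition is at most `η`. -/
def TaggedPartition.MeshLE {T : ℝ≥0} (π : TaggedPartition T) (η : ℝ) : Prop :=
  ∀ i < π.n, (π.pts (i + 1) : ℝ) - π.pts i ≤ η

/-- The Riemann–Stieltjes sum `∑ f(ξᵢ) (Z(tᵢ₊₁) - Z(tᵢ))`. -/
def riemannSum {Ω : Type*} (f : ℝ → ℝ) (Z : ℝ≥0 → Ω → ℝ) {T : ℝ≥0} (π : TaggedPartition T)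
    (ω : Ω) : ℝ :=
  ∑ i ∈ Finset.range π.n, f (π.tags i) * (Z (π.pts (i + 1)) ω - Z (π.pts i) ω)

/-- `Y = ∫₀ᵀ f(u) dZ(u)` for a deterministic integrand `f`: the random variable `Y` is the limit
in probability of the Riemann–Stieltjes sums as the mesh of the tagged partition tends to `0`. -/
def IsIntegral {Ω : Type*} [MeasurableSpace Ω] (f : ℝ → ℝ) (Z : ℝ≥0 → Ω → ℝ) (P : Measure Ω)
    (T : ℝ≥0) (Y : Ω → ℝ) : Prop :=
  AEMeasurable Y P ∧
    ∀ ε : ℝ, 0 < ε → ∀ δ : ℝ, 0 < δ → ∃ η : ℝ, 0 < η ∧ ∀ π : TaggedPartition T, π.MeshLE η →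
      P {ω | ε ≤ |riemannSum f Z π ω - Y ω|} ≤ ENNReal.ofReal δ

/-- `U = ∫₀^∞ f(u) dZ(u)`: the random variable `U` is the limit in probability of
`∫₀ᵀ f(u) dZ(u)` as `T → ∞`. -/
def IsImproperIntegral {Ω : Type*} [MeasurableSpace Ω] (f : ℝ → ℝ) (Z : ℝ≥0 → Ω → ℝ)
    (P : Measure Ω) (U : Ω → ℝ) : Prop :=
  AEMeasurable U P ∧
    ∃ Y : ℝ≥0 → Ω → ℝ, (∀ T, IsIntegral f Z P T (Y T)) ∧ TendstoInMeasure P Y atTop U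

/-- `ψ` is a Lévy–Khintchine exponent with Lévy measure `ν` (with some drift `b` and some
Gaussian variance `v`). -/
def IsLevyExponent (ψ : ℝ → ℂ) (ν : Measure ℝ) : Prop :=
  ν {0} = 0 ∧ ∫⁻ x, ENNReal.ofReal (min 1 (x ^ 2)) ∂ν < ∞ ∧
    ∃ (b : ℝ) (v : ℝ≥0), ∀ t : ℝ,
      ψ t = Complex.I * t * b - (v : ℝ) * t ^ 2 / 2 +
        ∫ x : ℝ, (Complex.exp (Complex.I * t * x) - 1 -
          Complex.I * t * x * (if |x| ≤ 1 then 1 else 0)) ∂ν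

/-- The distribution `μ` on `ℝ` is infinitely divisible with Lévy measure `ν`, i.e. its
characteristic function is `exp ψ` for a Lévy–Khintchine exponent `ψ` with Lévy measure `ν`. -/
def HasLevyMeasure (μ : Measure ℝ) (ν : Measure ℝ) : Prop :=
  ∃ ψ : ℝ → ℂ, IsLevyExponent ψ ν ∧ ∀ t : ℝ, charFun μ t = Complex.exp (ψ t)

/-- `c_k = 1` for `k < 0` and `c_k = 0` for `k ≥ 0`. -/
def c (k : ℤ) : ℝ := if k < 0 then 1 else 0

/-- The exponent of the limit process `Z`:
`∑_k (exp(i t s r^k) - 1 - i t s r^k c_k) p q^k`. -/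
def exponentZ (p q r s : ℝ) (t : ℝ) : ℂ :=
  ∑' k : ℤ, (Complex.exp (Complex.I * t * (s * r ^ k : ℝ)) - 1 -
    Complex.I * t * (s * r ^ k : ℝ) * c k) * (p * q ^ k : ℝ)

/-- The integrand `q^k (e^{itx} - 1 - i t x c_k) / x`. -/
def integrandU (q : ℝ) (t : ℝ) (k : ℤ) (x : ℝ) : ℂ :=
  (q ^ k : ℝ) * (Complex.exp (Complex.I * t * x) - 1 - Complex.I * t * x * c k) / x

/-- `∫_{s r^{k-1}}^{s r^k} q^k (e^{itx} - 1 - i t x c_k) dx/x`. -/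
def termU (q r s : ℝ) (t : ℝ) (k : ℤ) : ℂ :=
  ∫ x in (s * r ^ (k - 1))..(s * r ^ k), integrandU q t k x

/-- `g(t) = i t s q + ∑_k ∫_{s r^{k-1}}^{s r^k} q^k (e^{itx} - 1 - i t x c_k) dx/x`. -/
def g (q r s : ℝ) (t : ℝ) : ℂ :=
  Complex.I * t * s * q + ∑' k : ℤ, termU q r s t k

/-- The measure on `ℝ` with density `q^k / (a x)` at `x ∈ (s r^{k-1}, s r^k]`, `k ∈ ℤ`
(and density `0` at `x ≤ 0`). -/
def levyMeasureU (q r s a : ℝ) : Measure ℝ :=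
  volume.withDensity fun x =>
    ∑' k : ℤ, (Set.Ioc (s * r ^ (k - 1)) (s * r ^ k)).indicator
      (fun y => ENNReal.ofReal (q ^ k / (a * y))) x

end

end StPetersburg

/-!
Write `φ_k(x) = e^{ix} - 1 - i x c_k` and `ψ = ∑ p q^k φ_k(· s r^k)` for the exponent of `Z`. Everything
rests on one estimate (`zpow_mul_norm_truncExp_le`): using `|e^{ix} - 1 - ix| ≤ 3x²` for the small jumps
and `|e^{ix} - 1| ≤ 2√|x|` for the large ones, the `k`-th term at `y` is at most a constant times
`(√q)^{|k|} (y² + √|y|)`. Hence `ψ` is continuous, `|ψ(y)| ≤ C (y² + √|y|)`, and `ψ(t e^{-au})` is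
integrable in `u > 0`.

*The integral.* A finite combination `∑ b_i (Z(v_i) - Z(u_i))` is the integral of the step function
`h = ∑ b_i 1_{(u_i, v_i]}` and has characteristic function `exp ∫ ψ(t h(x)) dx`: refine to a common
grid and use independence and stationarity (`charFun_stepIntegral`). Riemann–Stieltjes sums, and
differences of two of them, are of this form. As the mesh shrinks the step functions converge to
`e^{-ax}`, or their differences to `0`, and they are dominated by `e^a e^{-ax}`. So dominated convergence
shows that the sums are Cauchy in probability, both for fixed `T` and as `T → ∞`, which gives the
existence of `U`; along a diagonal sequence of partitions it gives
`E e^{itU} = exp ∫_0^∞ ψ(t e^{-au}) du`.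

*The exponent.* Integrating the series termwise and substituting `y = s r^k e^{-au}`, the exponent of `U`
is `(1/a) ∑ p q^k A_k` with `A_k = ∫_0^{s r^k} φ_k(ty) dy/y`. As `p q^k = q^k - q^{k+1}`, summation by parts
turns this into `(1/a) ∑ q^k (A_k - A_{k-1})`, and `q^k (A_k - A_{k-1})` is the `k`-th integral in the
definition of `g`, except that for `k = 0` the change from `c_{-1} = 1` to `c_0 = 0` contributes the
drift `itsq` (`hasSum_termU`).

*The Lévy measure.* The convention `c_k` is truncation at `|x| ≤ s q`. Replacing it by truncation at
`|x| ≤ 1` changes only the drift, since the two truncated linear terms differ by a function that is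
integrable against the Lévy measure (`isLevyExponent_g_div`).
-/

namespace StPetersburg

/-! ### Convergence in probability -/

section InProbability

variable {Ω : Type*} [MeasurableSpace Ω] {P : Measure Ω}

lemma measure_le_abs_sub_le_add (X Y W : Ω → ℝ) (ε : ℝ) :
    P {ω | ε ≤ |X ω - W ω|} ≤
      P {ω | ε / 2 ≤ |X ω - Y ω|} + P {ω | ε / 2 ≤ |Y ω - W ω|} := by
  refine (measure_mono fun ω hω => ?_).trans (measure_union_le _ _)
  simp only [Set.mem_ofPred_eq, Set.mem_union] at hω ⊢
  by_contra! h
  linarith [abs_sub_le (X ω) (Y ω) (W ω), h.1, h.2]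

/-- A sequence of random variables that is Cauchy in probability converges in probability: a
rapidly converging subsequence converges almost surely, by the Borel–Cantelli lemma. -/
lemma exists_tendsto_measure_of_cauchy [IsFiniteMeasure P] (X : ℕ → Ω → ℝ)
    (hX : ∀ n, Measurable (X n))
    (hC : ∀ ε : ℝ, 0 < ε → ∀ δ : ℝ≥0∞, 0 < δ → ∃ N, ∀ m ≥ N, ∀ n ≥ N,
      P {ω | ε ≤ |X m ω - X n ω|} ≤ δ) :
    ∃ Y : Ω → ℝ, Measurable Y ∧
      ∀ ε : ℝ, 0 < ε → Tendsto (fun n => P {ω | ε ≤ |X n ω - Y ω|}) atTop (𝓝 0) := by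
  have h2 : ∀ k : ℕ, (0 : ℝ≥0∞) < (2⁻¹ : ℝ≥0∞) ^ k := fun k =>
    ENNReal.pow_pos (by simp) k
  choose N hN using fun k : ℕ => hC ((1 / 2 : ℝ) ^ k) (by positivity) ((2⁻¹ : ℝ≥0∞) ^ k) (h2 k)
  -- `M` is monotone, dominates `N`, and tends to infinity
  let M : ℕ → ℕ := fun k => k + ∑ j ∈ Finset.range (k + 1), N j
  have hMN : ∀ k, N k ≤ M k := fun k =>
    (Finset.single_le_sum (f := N) (fun _ _ => Nat.zero_le _)
      (Finset.self_mem_range_succ k)).trans (Nat.le_add_left _ _)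
  have hMsucc : ∀ k, M k ≤ M (k + 1) := fun k => by
    simp only [M]; rw [Finset.sum_range_succ _ (k + 1)]; omega
  have hMk : ∀ k, k ≤ M k := fun k => Nat.le_add_right _ _
  have hBC := ae_eventually_notMem
    (μ := P) (s := fun k => {ω | (1 / 2 : ℝ) ^ k ≤ |X (M k) ω - X (M (k + 1)) ω|}) (by
      refine ne_top_of_le_ne_top ?_ (ENNReal.tsum_le_tsum fun k =>
        hN k (M k) (hMN k) (M (k + 1)) ((hMN k).trans (hMsucc k)))
      rw [ENNReal.tsum_geometric]; simp)
  have hlim : ∀ᵐ ω ∂P, ∃ y : ℝ, Tendsto (fun k => X (M k) ω) atTop (𝓝 y) := by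
    filter_upwards [hBC] with ω hω
    obtain ⟨K, hK⟩ := eventually_atTop.1 hω
    have : CauchySeq fun k => X (M (k + K)) ω := by
      refine cauchySeq_of_le_geometric (1 / 2) 1 (by norm_num) fun k => ?_
      have := hK (k + K) (Nat.le_add_left _ _)
      simp only [not_le] at this
      rw [Real.dist_eq, one_mul]
      refine (show k + 1 + K = k + K + 1 by ring) ▸ this.le.trans ?_
      exact pow_le_pow_of_le_one (by norm_num) (by norm_num) (Nat.le_add_right _ _)
    obtain ⟨y, hy⟩ := cauchySeq_tendsto_of_complete this
    exact ⟨y, (tendsto_add_atTop_iff_nat K).1 hy⟩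
  obtain ⟨Y, hYm, hY⟩ := measurable_limit_of_tendsto_metrizable_ae
    (fun k => (hX (M k)).aemeasurable) hlim
  have hMY := tendstoInMeasure_iff_norm.1
    (tendstoInMeasure_of_tendsto_ae (fun k => (hX (M k)).aestronglyMeasurable) hY)
  refine ⟨Y, hYm, fun ε hε => ENNReal.tendsto_nhds_zero.2 fun δ hδ => ?_⟩
  obtain ⟨n₀, hn₀⟩ := hC (ε / 2) (half_pos hε) (δ / 2) (ENNReal.half_pos hδ.ne')
  obtain ⟨k₀, hk₀⟩ := eventually_atTop.1
    (ENNReal.tendsto_nhds_zero.1 (hMY (ε / 2) (half_pos hε)) (δ / 2) (ENNReal.half_pos hδ.ne'))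
  filter_upwards [eventually_ge_atTop n₀] with n hn
  refine (measure_le_abs_sub_le_add _ (X (M (max n₀ k₀))) _ ε).trans ?_
  rw [← ENNReal.add_halves δ]
  exact add_le_add (hn₀ n hn _ ((le_max_left _ _).trans (hMk _))) (hk₀ _ (le_max_right _ _))

/-- If the characteristic functions converge pointwise to `1`, the random variables converge to
`0` in probability. -/
lemma tendsto_measure_of_tendsto_charFun_one [IsProbabilityMeasure P] (D : ℕ → Ω → ℝ)
    (hD : ∀ n, Measurable (D n))
    (h : ∀ t : ℝ, Tendsto (fun n => charFun (P.map (D n)) t) atTop (𝓝 1)) (ε : ℝ) (hε : 0 < ε) :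
    Tendsto (fun n => P {ω | ε ≤ |D n ω|}) atTop (𝓝 0) := by
  have hprob : ∀ n, IsProbabilityMeasure (P.map (D n)) := fun n =>
    Measure.isProbabilityMeasure_map (hD n).aemeasurable
  set r : ℝ := ε / 2 with hr
  have hr0 : 0 < r := half_pos hε
  have hint : Tendsto (fun n => ∫ t in (-2 * r⁻¹)..(2 * r⁻¹), 1 - charFun (P.map (D n)) t)
      atTop (𝓝 (∫ t in (-2 * r⁻¹)..(2 * r⁻¹), (0 : ℂ))) := by
    refine intervalIntegral.tendsto_integral_filter_of_dominated_convergence (fun _ => 2)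
      (Eventually.of_forall fun n => ?_) (Eventually.of_forall fun n => ?_) (by simp) ?_
    · exact (continuous_const.sub continuous_charFun).aestronglyMeasurable
    · exact Eventually.of_forall fun t _ => norm_one_sub_charFun_le_two
    · exact Eventually.of_forall fun t _ => by simpa using (tendsto_const_nhds (x := 1)).sub (h t)
  have hbound : Tendsto (fun n => (P.map (D n)).real {x | r < |x|}) atTop (𝓝 0) := by
    refine squeeze_zero (fun n => measureReal_nonneg)
      (fun n => measureReal_abs_gt_le_integral_charFun hr0) ?_
    simpa using hint.norm.const_mul (2⁻¹ * r)
  have hreal : Tendsto (fun n => P.real {ω | ε ≤ |D n ω|}) atTop (𝓝 0) := by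
    refine squeeze_zero (fun n => measureReal_nonneg) (fun n => ?_) hbound
    have hms : MeasurableSet {x : ℝ | r < |x|} :=
      (isOpen_lt continuous_const continuous_abs).measurableSet
    rw [map_measureReal_apply (hD n) hms]
    exact measureReal_mono fun ω (hω : ε ≤ |D n ω|) => show r < |D n ω| by linarith
  simpa [measureReal_def, ENNReal.tendsto_toReal_zero_iff (fun _ => measure_ne_top P _)] using hreal

/-- Convergence in probability identifies the characteristic function of the limit. -/
lemma charFun_eq_of_tendstoInMeasure [IsProbabilityMeasure P] {X : ℕ → Ω → ℝ} {U : Ω → ℝ}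
    (hX : ∀ n, Measurable (X n)) (hU : AEMeasurable U P) (h : TendstoInMeasure P X atTop U)
    {t : ℝ} {z : ℂ} (hz : Tendsto (fun n => charFun (P.map (X n)) t) atTop (𝓝 z)) :
    charFun (P.map U) t = z := by
  obtain ⟨ns, hns, hae⟩ := h.exists_seq_tendsto_ae
  have hchar : ∀ V : Ω → ℝ, AEMeasurable V P →
      charFun (P.map V) t = ∫ ω, Complex.exp (t * V ω * Complex.I) ∂P := fun V hV => by
    rw [charFun_apply_real, integral_map hV (by fun_prop)]
  refine tendsto_nhds_unique ?_ (hz.comp hns.tendsto_atTop)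
  rw [hchar U hU]
  simp only [Function.comp_def, hchar _ (hX _).aemeasurable]
  refine tendsto_integral_of_dominated_convergence (fun _ => 1) (fun n => ?_) (by simp)
    (fun n => Eventually.of_forall fun ω => ?_) ?_
  · have := hX (ns n)
    exact (by fun_prop : Measurable fun ω =>
      Complex.exp (t * X (ns n) ω * Complex.I)).aestronglyMeasurable
  · rw [← Complex.ofReal_mul, Complex.norm_exp_ofReal_mul_I]
  · filter_upwards [hae] with ω hω
    exact (Continuous.tendsto (by fun_prop : Continuous fun x : ℝ =>
      Complex.exp (t * x * Complex.I)) _).comp hω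

end InProbability

/-! ### Integrals of step functions against a Lévy process -/

section Step

variable {Ω : Type*} [MeasurableSpace Ω] {P : Measure Ω} {ι : Type*}

/-- The step function `∑ b i • 1_{(u i, v i]}`. The intervals may overlap. -/
noncomputable def stepFun (S : Finset ι) (b : ι → ℝ) (u v : ι → ℝ≥0) (x : ℝ) : ℝ :=
  ∑ i ∈ S, (Set.Ioc (u i : ℝ) (v i)).indicator (fun _ => b i) x

/-- The integral `∑ b i (Z (v i) - Z (u i))` of `stepFun S b u v` against the process `Z`. -/
noncomputable def stepIntegral (S : Finset ι) (b : ι → ℝ) (u v : ι → ℝ≥0) (Z : ℝ≥0 → Ω → ℝ)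
    (ω : Ω) : ℝ :=
  ∑ i ∈ S, b i * (Z (v i) ω - Z (u i) ω)

lemma measurable_stepFun (S : Finset ι) (b : ι → ℝ) (u v : ι → ℝ≥0) :
    Measurable (stepFun S b u v) :=
  Finset.measurable_fun_sum S fun _ _ => measurable_const.indicator measurableSet_Ioc

lemma stepFun_disjSum {κ : Type*} (S : Finset ι) (b : ι → ℝ) (u v : ι → ℝ≥0) (S' : Finset κ)
    (b' : κ → ℝ) (u' v' : κ → ℝ≥0) (x : ℝ) :
    stepFun (S.disjSum S') (Sum.elim b fun i => -b' i) (Sum.elim u u') (Sum.elim v v') x =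
      stepFun S b u v x - stepFun S' b' u' v' x := by
  rw [stepFun, Finset.sum_disjSum, sub_eq_add_neg, stepFun, stepFun, ← Finset.sum_neg_distrib]
  refine congrArg₂ _ rfl (Finset.sum_congr rfl fun i _ => ?_)
  exact congrFun (Set.indicator_neg _ fun _ => b' i) x

/-- Finitely many times are contained in a monotone grid. -/
lemma exists_monotone_range_supset (A : Finset ℝ≥0) :
    ∃ (N : ℕ) (τ : ℕ → ℝ≥0), Monotone τ ∧ ∀ x ∈ A, ∃ k ≤ N, τ k = x := by
  have hcard : 0 < (insert 0 A).card := Finset.card_pos.2 (Finset.insert_nonempty _ _)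
  obtain ⟨N, hN⟩ := Nat.exists_eq_succ_of_ne_zero hcard.ne'
  refine ⟨N, fun j => (insert 0 A).orderEmbOfFin hN ⟨min j N, by omega⟩, fun i j hij => ?_,
    fun x hx => ?_⟩
  · exact ((insert 0 A).orderEmbOfFin hN).monotone (by simp only [Fin.mk_le_mk]; omega)
  · have : x ∈ Set.range ((insert 0 A).orderEmbOfFin hN) := by
      rw [Finset.range_orderEmbOfFin]; simp [hx]
    obtain ⟨k, hk⟩ := this
    refine ⟨k, Nat.lt_succ_iff.1 k.2, ?_⟩
    rw [← hk]
    ext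
    simp [Nat.lt_succ_iff.1 k.2]

/-- On each cell `(τ j, τ (j+1)]` of a grid containing both endpoints, the indicator of
`(τ k, τ l]` is constant. -/
lemma mem_Ioc_grid_iff {τ : ℕ → ℝ≥0} (hτ : Monotone τ) (j k l : ℕ) {x : ℝ}
    (hx : x ∈ Set.Ioc (τ j : ℝ) (τ (j + 1))) :
    x ∈ Set.Ioc (τ k : ℝ) (τ l) ↔ (τ (j + 1) : ℝ) ∈ Set.Ioc (τ k : ℝ) (τ l) := by
  have hlt : ∀ m n, (τ m : ℝ) < τ n → m < n := fun m n h => by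
    by_contra hc
    exact absurd (NNReal.coe_le_coe.2 (hτ (not_lt.1 hc))) (not_le.2 h)
  have hle : ∀ m n, m ≤ n → (τ m : ℝ) ≤ τ n := fun m n h => NNReal.coe_le_coe.2 (hτ h)
  refine and_congr ⟨fun h => h.trans_le hx.2, fun h => ?_⟩ ⟨fun h => ?_, fun h => hx.2.trans h⟩
  · exact (hle _ _ (Nat.lt_succ_iff.1 (hlt _ _ h))).trans_lt hx.1
  · exact hle _ _ (hlt _ _ (hx.1.trans_le h))

/-- An increment over `(τ k, τ l]` as a sum of increments over the cells of the grid. The grid may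
have repeated points, whose cells contribute nothing. -/
lemma sub_eq_sum_grid {τ : ℕ → ℝ≥0} (hτ : Monotone τ) (z : ℝ≥0 → ℝ) (b : ℝ) {k l N : ℕ}
    (hlN : l ≤ N) (hkl : τ k ≤ τ l) :
    b * (z (τ l) - z (τ k)) = ∑ j ∈ Finset.range N,
      (Set.Ioc (τ k : ℝ) (τ l)).indicator (fun _ => b) (τ (j + 1)) *
        (z (τ (j + 1)) - z (τ j)) := by
  rcases eq_or_lt_of_le hkl with h | h
  · simp [h]
  have hkl' : k < l := by
    by_contra hc
    exact absurd (hτ (not_lt.1 hc)) (not_le.2 h)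
  have hsub : Finset.Ico k l ⊆ Finset.range N := fun j hj => by
    simp only [Finset.mem_Ico, Finset.mem_range] at hj ⊢; omega
  rw [← Finset.sum_Ico_sub (fun j => z (τ j)) hkl'.le, Finset.mul_sum, ← Finset.sum_subset hsub]
  · refine Finset.sum_congr rfl fun j hj => ?_
    rw [Finset.mem_Ico] at hj
    -- if the indicator vanishes then the cell is degenerate and so is the increment
    by_cases hmem : (τ (j + 1) : ℝ) ∈ Set.Ioc (τ k : ℝ) (τ l)
    · rw [Set.indicator_of_mem hmem]
    · have h1 : τ (j + 1) ≤ τ l := hτ hj.2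
      have h2 : τ (j + 1) ≤ τ k := by
        by_contra hc
        exact hmem ⟨NNReal.coe_lt_coe.2 (not_le.1 hc), NNReal.coe_le_coe.2 h1⟩
      have h3 : τ (j + 1) = τ j :=
        le_antisymm (h2.trans (hτ hj.1)) (hτ (Nat.le_succ j))
      simp [h3]
  · intro j _ hj
    rw [Finset.mem_Ico, not_and_or, not_le, not_lt] at hj
    by_cases hmem : (τ (j + 1) : ℝ) ∈ Set.Ioc (τ k : ℝ) (τ l)
    · rcases hj with hj | hj
      · exact absurd (NNReal.coe_le_coe.2 (hτ (show j + 1 ≤ k from hj))) (not_le.2 hmem.1)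
      · have h3 : τ (j + 1) = τ j := le_antisymm
          ((NNReal.coe_le_coe.1 hmem.2).trans (hτ hj)) (hτ (Nat.le_succ j))
        simp [h3]
    · rw [Set.indicator_of_notMem hmem, zero_mul]

lemma charFun_map_sub (Z : ℝ≥0 → Ω → ℝ) (hZ : IsLevyProcess Z P) {ψ : ℝ → ℂ}
    (hψ : ∀ (u : ℝ≥0) (t : ℝ), charFun (P.map (Z u)) t = Complex.exp ((u : ℝ) * ψ t))
    {u v : ℝ≥0} (huv : u ≤ v) (t : ℝ) :
    charFun (P.map (fun ω => Z v ω - Z u ω)) t = Complex.exp (((v : ℝ) - u : ℝ) * ψ t) := by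
  have h := hZ.stationary u (v - u)
  rw [add_tsub_cancel_of_le huv] at h
  rw [h, hψ, NNReal.coe_sub huv]

/-- The integral of a step function `h` against a Lévy process with exponent `ψ` has
characteristic function `exp (∫ ψ (t h(x)) dx)`. -/
theorem charFun_stepIntegral (Z : ℝ≥0 → Ω → ℝ) (hZ : IsLevyProcess Z P)
    {ψ : ℝ → ℂ} (hψ0 : ψ 0 = 0)
    (hψ : ∀ (u : ℝ≥0) (t : ℝ), charFun (P.map (Z u)) t = Complex.exp ((u : ℝ) * ψ t))
    (S : Finset ι) (b : ι → ℝ) (u v : ι → ℝ≥0) (huv : ∀ i ∈ S, u i ≤ v i) (t : ℝ) :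
    charFun (P.map (stepIntegral S b u v Z)) t =
      Complex.exp (∫ x, ψ (t * stepFun S b u v x)) := by
  classical
  obtain ⟨N, τ, hτ, hA⟩ := exists_monotone_range_supset (S.image u ∪ S.image v)
  have hu : ∀ i ∈ S, ∃ k ≤ N, τ k = u i := fun i hi =>
    hA _ (Finset.mem_union_left _ (Finset.mem_image_of_mem _ hi))
  have hv : ∀ i ∈ S, ∃ k ≤ N, τ k = v i := fun i hi =>
    hA _ (Finset.mem_union_right _ (Finset.mem_image_of_mem _ hi))
  set β : ℕ → ℝ := fun j => stepFun S b u v (τ (j + 1)) with hβ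
  have hstep : ∀ j, ∀ x ∈ Set.Ioc (τ j : ℝ) (τ (j + 1)), stepFun S b u v x = β j := by
    intro j x hx
    refine Finset.sum_congr rfl fun i hi => ?_
    obtain ⟨k, -, hk⟩ := hu i hi
    obtain ⟨l, -, hl⟩ := hv i hi
    have := mem_Ioc_grid_iff hτ j k l hx
    rw [hk, hl] at this
    by_cases hm : x ∈ Set.Ioc (u i : ℝ) (v i)
    · rw [Set.indicator_of_mem hm, Set.indicator_of_mem (this.1 hm)]
    · rw [Set.indicator_of_notMem hm, Set.indicator_of_notMem (mt this.2 hm)]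
  have hsum : stepIntegral S b u v Z =
      fun ω => ∑ j ∈ Finset.range N, β j * (Z (τ (j + 1)) ω - Z (τ j) ω) := by
    ext ω
    simp only [stepIntegral, hβ, stepFun, Finset.sum_mul]
    rw [Finset.sum_comm]
    refine Finset.sum_congr rfl fun i hi => ?_
    obtain ⟨k, -, hk⟩ := hu i hi
    obtain ⟨l, hlN, hl⟩ := hv i hi
    rw [← hk, ← hl]
    exact sub_eq_sum_grid hτ (fun y => Z y ω) (b i) hlN (by rw [hk, hl]; exact huv i hi)
  have hzero : ∀ x ∉ Set.Ioc (τ 0 : ℝ) (τ N), ψ (t * stepFun S b u v x) = 0 := by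
    intro x hx
    have : stepFun S b u v x = 0 := Finset.sum_eq_zero fun i hi => by
      obtain ⟨k, -, hk⟩ := hu i hi
      obtain ⟨l, hlN, hl⟩ := hv i hi
      refine Set.indicator_of_notMem (fun hm => hx ⟨?_, ?_⟩) _
      · exact (NNReal.coe_le_coe.2 (hk ▸ hτ (Nat.zero_le k))).trans_lt hm.1
      · exact hm.2.trans (NNReal.coe_le_coe.2 (hl ▸ hτ hlN))
    rw [this, mul_zero, hψ0]
  have hcell : ∀ j, Set.EqOn (fun x => ψ (t * stepFun S b u v x)) (fun _ => ψ (t * β j))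
      (Set.Ioc (τ j : ℝ) (τ (j + 1))) := fun j x hx => by simp only [hstep j x hx]
  have hle : ∀ j, (τ j : ℝ) ≤ τ (j + 1) := fun j => NNReal.coe_le_coe.2 (hτ (Nat.le_succ j))
  have hint : ∫ x, ψ (t * stepFun S b u v x) =
      ∑ j ∈ Finset.range N, ((τ (j + 1) : ℝ) - τ j : ℝ) * ψ (t * β j) := by
    rw [← setIntegral_eq_integral_of_forall_compl_eq_zero hzero,
      ← intervalIntegral.integral_of_le (NNReal.coe_le_coe.2 (hτ (Nat.zero_le N))),
      ← intervalIntegral.sum_integral_adjacent_intervals (a := fun j => (τ j : ℝ))]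
    · refine Finset.sum_congr rfl fun j _ => ?_
      rw [intervalIntegral.integral_of_le (hle j),
        setIntegral_congr_fun measurableSet_Ioc (hcell j),
        ← intervalIntegral.integral_of_le (hle j), intervalIntegral.integral_const]
      simp
    · intro j _
      rw [intervalIntegrable_iff_integrableOn_Ioc_of_le (hle j)]
      exact (integrableOn_congr_fun (hcell j) measurableSet_Ioc).2 (integrableOn_const (by simp))
  have hmeas : ∀ j, Measurable fun ω => Z (τ (j + 1)) ω - Z (τ j) ω := fun j =>
    (hZ.measurable _).sub (hZ.measurable _)
  have hind : iIndepFun (fun j ω => β j * (Z (τ (j + 1)) ω - Z (τ j) ω)) P :=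
    (hZ.indep.nat hτ).comp (fun j x => β j * x) fun j => measurable_const_mul _
  rw [hsum, (hind.restrict _).charFun_map_fun_finsetSum_eq_prod
    (fun j _ => ((hmeas j).const_mul _).aemeasurable), hint, Complex.exp_sum, Finset.prod_apply]
  refine Finset.prod_congr rfl fun j _ => ?_
  have hmap : P.map (fun ω => β j * (Z (τ (j + 1)) ω - Z (τ j) ω)) =
      (P.map (fun ω => Z (τ (j + 1)) ω - Z (τ j) ω)).map (β j * ·) := by
    rw [Measure.map_map (measurable_const_mul _) (hmeas j)]; rfl
  rw [hmap, charFun_map_mul, charFun_map_sub Z hZ hψ (hτ (Nat.le_succ j)), mul_comm t]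

end Step

/-! ### The exponent of `Z` -/

/-- The truncated exponential `e^{ix} - 1 - i x c_k`. -/
noncomputable def truncExp (k : ℤ) (x : ℝ) : ℂ :=
  Complex.exp (Complex.I * x) - 1 - Complex.I * x * c k

lemma continuous_truncExp (k : ℤ) : Continuous (truncExp k) := by
  unfold truncExp; fun_prop

lemma norm_cexp_sub_one_le_sqrt (x : ℝ) :
    ‖Complex.exp (Complex.I * x) - 1‖ ≤ 2 * √|x| := by
  have hs := Real.sqrt_nonneg |x|
  have hsq := Real.sq_sqrt (abs_nonneg x)
  rcases le_total |x| 1 with h | h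
  · refine Real.norm_exp_I_mul_ofReal_sub_one_le.trans ?_
    rw [Real.norm_eq_abs]
    nlinarith [Real.sqrt_le_one.2 h]
  · refine (norm_sub_le _ _).trans ?_
    rw [Complex.norm_exp_I_mul_ofReal, norm_one]
    linarith [Real.one_le_sqrt.2 h]

lemma norm_cexp_sub_one_sub_le_sq (x : ℝ) :
    ‖Complex.exp (Complex.I * x) - 1 - Complex.I * x‖ ≤ 3 * x ^ 2 := by
  have hnorm : ‖Complex.I * (x : ℂ)‖ = |x| := by simp
  rcases le_total |x| 1 with h | h
  · refine (Complex.norm_exp_sub_one_sub_id_le (by rwa [hnorm])).trans ?_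
    rw [hnorm, sq_abs]; nlinarith [sq_nonneg x]
  · refine (norm_sub_le _ _).trans ((add_le_add (norm_sub_le _ _) le_rfl).trans ?_)
    rw [Complex.norm_exp_I_mul_ofReal, norm_one, hnorm, ← sq_abs]
    nlinarith

lemma truncExp_of_neg {k : ℤ} (hk : k < 0) (x : ℝ) :
    truncExp k x = Complex.exp (Complex.I * x) - 1 - Complex.I * x := by
  simp [truncExp, c, hk]

lemma truncExp_of_nonneg {k : ℤ} (hk : 0 ≤ k) (x : ℝ) :
    truncExp k x = Complex.exp (Complex.I * x) - 1 := by
  simp [truncExp, c, not_lt.2 hk]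

/-- The weight `K (√q)^{|k|}` controlling the `k`-th jump size. -/
noncomputable def weight (q s : ℝ) (k : ℤ) : ℝ := 3 * (s ^ 2 + √s) * √q ^ k.natAbs

lemma summable_pow_natAbs {x : ℝ} (h0 : 0 ≤ x) (h1 : x < 1) :
    Summable fun k : ℤ => x ^ k.natAbs :=
  Summable.of_nat_of_neg (by simpa using summable_geometric_of_lt_one h0 h1)
    (by simpa using summable_geometric_of_lt_one h0 h1)

lemma summable_weight {q s : ℝ} (hq1 : q < 1) : Summable (weight q s) :=
  (summable_pow_natAbs (Real.sqrt_nonneg q)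
    ((Real.sqrt_lt' one_pos).2 (by simpa using hq1))).mul_left _

lemma zpow_mul_zpow_eq_one {q r : ℝ} (hq0 : 0 < q) (hr : r = 1 / q) (k : ℤ) : q ^ k * r ^ k = 1 := by
  rw [← mul_zpow, hr, mul_one_div_cancel hq0.ne', one_zpow]

/-- Jumps of size `s r^k` have rate of order `q^k`. For `k < 0` the quadratic bound on `truncExp`
gains `r^{2k} = q^{-2k}`, for `k ≥ 0` the square root bound loses only `r^{k/2} = q^{-k/2}`: in both
cases the contribution decays at least like `(√q)^{|k|}`. -/
lemma zpow_mul_norm_truncExp_le {q r s : ℝ} (hq0 : 0 < q) (hq1 : q < 1) (hr : r = 1 / q)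
    (hs : 0 < s) (k : ℤ) (y : ℝ) :
    q ^ k * ‖truncExp k (y * (s * r ^ k))‖ ≤ weight q s k * (y ^ 2 + √|y|) := by
  have hr0 : 0 < r := by rw [hr]; positivity
  have hqr := zpow_mul_zpow_eq_one hq0 hr k
  have hsq : √q ^ 2 = q := Real.sq_sqrt hq0.le
  have hs1 : √q ≤ 1 := Real.sqrt_le_one.2 hq1.le
  have hs0 : 0 < √q := Real.sqrt_pos.2 hq0
  rcases lt_or_ge k 0 with hk | hk
  · obtain ⟨n, rfl⟩ : ∃ n : ℕ, k = -n := ⟨k.natAbs, by omega⟩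
    rw [truncExp_of_neg hk]
    have hrn : r ^ (-(n : ℤ)) = q ^ n := by rw [hr, zpow_neg, zpow_natCast]; simp
    have hpow : q ^ n ≤ √q ^ n := by
      gcongr
      nlinarith
    calc q ^ (-(n : ℤ)) * ‖_‖ ≤ q ^ (-(n : ℤ)) * (3 * (y * (s * r ^ (-(n : ℤ)))) ^ 2) := by
          gcongr; exact norm_cexp_sub_one_sub_le_sq _
      _ = (q ^ (-(n : ℤ)) * r ^ (-(n : ℤ))) * (3 * s ^ 2 * y ^ 2 * r ^ (-(n : ℤ))) := by ring
      _ = 3 * s ^ 2 * q ^ n * y ^ 2 := by rw [hqr, hrn]; ring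
      _ ≤ 3 * (s ^ 2 + √s) * √q ^ n * (y ^ 2 + √|y|) := by
          gcongr
          · linarith [Real.sqrt_nonneg s]
          · linarith [Real.sqrt_nonneg |y|]
      _ = _ := by simp [weight]
  · obtain ⟨n, rfl⟩ : ∃ n : ℕ, k = n := ⟨k.natAbs, by omega⟩
    rw [truncExp_of_nonneg hk]
    simp only [zpow_natCast] at hqr ⊢
    have hsqrt : q ^ n * √(r ^ n) = √q ^ n := by
      have h1 : √q ^ n = √(q ^ n) := by
        rw [eq_comm, Real.sqrt_eq_iff_mul_self_eq (by positivity) (by positivity), ← mul_pow,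
          Real.mul_self_sqrt hq0.le]
      have h2 : √(q ^ n) * √(r ^ n) = 1 := by
        rw [← Real.sqrt_mul (by positivity), hqr, Real.sqrt_one]
      rw [h1]
      calc q ^ n * √(r ^ n) = √(q ^ n) * (√(q ^ n) * √(r ^ n)) := by
            rw [← mul_assoc, Real.mul_self_sqrt (by positivity)]
        _ = _ := by rw [h2, mul_one]
    calc q ^ n * ‖_‖ ≤ q ^ n * (2 * √|y * (s * r ^ n)|) := by
          gcongr; exact norm_cexp_sub_one_le_sqrt _
      _ = 2 * √s * (q ^ n * √(r ^ n)) * √|y| := by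
          rw [abs_mul, abs_of_pos (show 0 < s * r ^ n by positivity), Real.sqrt_mul (abs_nonneg y),
            Real.sqrt_mul hs.le]
          ring
      _ ≤ 3 * (s ^ 2 + √s) * √q ^ n * (y ^ 2 + √|y|) := by
          rw [hsqrt]
          have hc : 2 * √s ≤ 3 * (s ^ 2 + √s) := by nlinarith [Real.sqrt_nonneg s, sq_nonneg s]
          have hy : √|y| ≤ y ^ 2 + √|y| := by linarith [sq_nonneg y]
          gcongr
      _ = _ := by simp [weight]

lemma exponentZ_eq (p q r s t : ℝ) :
    exponentZ p q r s t = ∑' k : ℤ, truncExp k (t * (s * r ^ k)) * (p * q ^ k : ℝ) := by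
  simp only [exponentZ, truncExp, Complex.ofReal_mul, mul_assoc]

section Exponent

variable {p q r s : ℝ} (hp : 0 ≤ p) (hq0 : 0 < q) (hq1 : q < 1) (hr : r = 1 / q) (hs : 0 < s)
include hp hq0 hq1 hr hs

lemma norm_exponentZ_term_le (k : ℤ) (t : ℝ) :
    ‖truncExp k (t * (s * r ^ k)) * (p * q ^ k : ℝ)‖ ≤ p * weight q s k * (t ^ 2 + √|t|) := by
  rw [norm_mul, Complex.norm_real, Real.norm_of_nonneg (by positivity), mul_comm, mul_assoc,
    mul_assoc]
  exact mul_le_mul_of_nonneg_left (zpow_mul_norm_truncExp_le hq0 hq1 hr hs k t) hp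

lemma norm_exponentZ_le (t : ℝ) :
    ‖exponentZ p q r s t‖ ≤ (∑' k, p * weight q s k) * (t ^ 2 + √|t|) := by
  rw [exponentZ_eq, ← tsum_mul_right]
  exact tsum_of_norm_bounded
    (((summable_weight hq1).mul_left p).mul_right (t ^ 2 + √|t|)).hasSum
    fun k => norm_exponentZ_term_le hp hq0 hq1 hr hs k t

lemma continuous_exponentZ : Continuous (exponentZ p q r s) := by
  have h : ∀ R : ℝ, ContinuousOn (exponentZ p q r s) (Metric.ball 0 R) := fun R => by
    simp only [funext (exponentZ_eq p q r s)]
    refine continuousOn_tsum (u := fun k => p * weight q s k * (R ^ 2 + √R))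
      (fun k => Continuous.continuousOn (by have := continuous_truncExp k; fun_prop))
      (((summable_weight hq1).mul_left p).mul_right _) fun k t ht => ?_
    rw [mem_ball_zero_iff, Real.norm_eq_abs] at ht
    refine (norm_exponentZ_term_le hp hq0 hq1 hr hs k t).trans ?_
    have hw : 0 ≤ weight q s k := by unfold weight; positivity
    have hR : 0 ≤ R := (abs_nonneg t).trans ht.le
    rw [← sq_abs t]
    gcongr
  exact continuous_iff_continuousAt.2 fun t => (h (|t| + 1)).continuousAt
    (Metric.isOpen_ball.mem_nhds (by simp [Metric.mem_ball]))

end Exponent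

lemma exponentZ_zero (p q r s : ℝ) : exponentZ p q r s 0 = 0 := by
  simp [exponentZ]

/-! ### The integrated exponent -/

/-- The substitution `y = x e^{-au}` maps `(0, ∞)` onto `(0, x)`. -/
lemma image_mul_exp_Ioi {a x : ℝ} (ha : 0 < a) (hx : 0 < x) :
    (fun u : ℝ => x * Real.exp (-a * u)) '' Set.Ioi 0 = Set.Ioo 0 x := by
  ext y
  simp only [Set.mem_image, Set.mem_Ioi, Set.mem_Ioo]
  constructor
  · rintro ⟨u, hu, rfl⟩
    refine ⟨by positivity, ?_⟩
    have : Real.exp (-a * u) < 1 := by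
      rw [← Real.exp_zero]
      exact Real.exp_lt_exp.2 (by nlinarith)
    nlinarith
  · rintro ⟨hy, hyx⟩
    have hlog : Real.log (y / x) < 0 := Real.log_neg (by positivity) ((div_lt_one hx).2 hyx)
    refine ⟨-Real.log (y / x) / a, div_pos (by linarith) ha, ?_⟩
    rw [show -a * (-Real.log (y / x) / a) = Real.log (y / x) by field_simp,
      Real.exp_log (by positivity)]
    field_simp

lemma hasDerivWithinAt_mul_exp (a x u : ℝ) (A : Set ℝ) :
    HasDerivWithinAt (fun u : ℝ => x * Real.exp (-a * u)) (-(a * (x * Real.exp (-a * u)))) A u := by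
  have h := ((((hasDerivAt_id u).const_mul (-a)).exp).const_mul x).hasDerivWithinAt (s := A)
  refine h.congr_deriv ?_
  simp only [id]; ring

section ExpSubst

variable {a x : ℝ} (ha : 0 < a) (hx : 0 < x)
include ha hx

lemma injOn_mul_exp (A : Set ℝ) : Set.InjOn (fun u : ℝ => x * Real.exp (-a * u)) A := by
  intro u _ v _ h
  have h1 := Real.exp_injective (mul_left_cancel₀ hx.ne' h)
  have : a * u = a * v := by linarith
  exact mul_left_cancel₀ ha.ne' this

lemma abs_deriv_smul_div (F : ℝ → ℂ) (u : ℝ) :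
    |-(a * (x * Real.exp (-a * u)))| •
      (F (x * Real.exp (-a * u)) / (x * Real.exp (-a * u) : ℝ)) =
    a * F (x * Real.exp (-a * u)) := by
  have h : 0 < x * Real.exp (-a * u) := by positivity
  have h' : ((x * Real.exp (-a * u) : ℝ) : ℂ) ≠ 0 := Complex.ofReal_ne_zero.2 h.ne'
  rw [abs_neg, abs_of_pos (by positivity), Complex.real_smul, Complex.ofReal_mul, mul_assoc,
    mul_div_cancel₀ _ h']

lemma integral_Ioc_div_eq (F : ℝ → ℂ) :
    ∫ y in Set.Ioc 0 x, F y / y = a * ∫ u in Set.Ioi (0 : ℝ), F (x * Real.exp (-a * u)) := by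
  rw [integral_Ioc_eq_integral_Ioo, ← image_mul_exp_Ioi ha hx,
    integral_image_eq_integral_abs_deriv_smul measurableSet_Ioi
      (fun u _ => hasDerivWithinAt_mul_exp a x u _) (injOn_mul_exp ha hx _)]
  simp only [abs_deriv_smul_div ha hx, integral_const_mul]

lemma integrableOn_Ioc_div_iff (F : ℝ → ℂ) :
    IntegrableOn (fun y => F y / (y : ℂ)) (Set.Ioc 0 x) ↔
      IntegrableOn (fun u => F (x * Real.exp (-a * u))) (Set.Ioi 0) := by
  rw [integrableOn_Ioc_iff_integrableOn_Ioo, ← image_mul_exp_Ioi ha hx,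
    integrableOn_image_iff_integrableOn_abs_deriv_smul measurableSet_Ioi
      (fun u _ => hasDerivWithinAt_mul_exp a x u _) (injOn_mul_exp ha hx _)]
  simp only [abs_deriv_smul_div ha hx]
  exact integrable_const_mul_iff (IsUnit.mk0 _ (Complex.ofReal_ne_zero.2 ha.ne')) _

end ExpSubst

/-- Integrability over `(0, ∞)` of the bound on the exponent along `t e^{-au}`. -/
lemma integrableOn_sq_add_sqrt_exp {a : ℝ} (ha : 0 < a) (t : ℝ) :
    IntegrableOn (fun u : ℝ => (t * Real.exp (-a * u)) ^ 2 + √|t * Real.exp (-a * u)|)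
      (Set.Ioi 0) := by
  have h1 := (exp_neg_integrableOn_Ioi 0 (b := 2 * a) (by linarith)).const_mul (t ^ 2)
  have h2 := (exp_neg_integrableOn_Ioi 0 (b := a / 2) (by linarith)).const_mul √|t|
  refine IntegrableOn.congr_fun (h1.add h2) (fun u _ => ?_) measurableSet_Ioi
  have e1 : Real.exp (-a * u) ^ 2 = Real.exp (-(2 * a) * u) := by
    rw [← Real.exp_nat_mul]; congr 1; push_cast; ring
  have e2 : √(Real.exp (-a * u)) = Real.exp (-(a / 2) * u) := by
    rw [← Real.exp_half]; congr 1; ring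
  simp only [Pi.add_apply]
  rw [mul_pow, abs_mul, Real.sqrt_mul (abs_nonneg t), abs_of_pos (Real.exp_pos _), e1, e2]

section Integrated

variable {p q r s a : ℝ} (hp : p = 1 - q) (hq0 : 0 < q) (hq1 : q < 1) (hr : r = 1 / q)
  (hs : 0 < s) (ha : 0 < a)
include hq0 hq1 hr hs ha

lemma integrableOn_truncExp_exp (t : ℝ) (k : ℤ) :
    IntegrableOn (fun u => truncExp k (t * Real.exp (-a * u) * (s * r ^ k))) (Set.Ioi 0) := by
  have hqk : (0 : ℝ) < q ^ k := by positivity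
  refine (((integrableOn_sq_add_sqrt_exp ha t).const_mul (weight q s k / q ^ k))).mono'
    (Continuous.aestronglyMeasurable (by have := continuous_truncExp k; fun_prop))
    (Eventually.of_forall fun u => ?_)
  rw [div_mul_eq_mul_div, le_div_iff₀ hqk, mul_comm]
  exact zpow_mul_norm_truncExp_le hq0 hq1 hr hs k _

/-- Termwise integration of the series defining the exponent of `Z`. -/
lemma hasSum_integral_truncExp (hp : 0 ≤ p) (t : ℝ) :
    HasSum (fun k : ℤ => (p * q ^ k : ℝ) *
        ∫ u in Set.Ioi (0 : ℝ), truncExp k (t * Real.exp (-a * u) * (s * r ^ k)))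
      (∫ u in Set.Ioi (0 : ℝ), exponentZ p q r s (t * Real.exp (-a * u))) := by
  have hint : ∀ k : ℤ, Integrable (fun u => truncExp k (t * Real.exp (-a * u) * (s * r ^ k)) *
      (p * q ^ k : ℝ)) (volume.restrict (Set.Ioi 0)) := fun k =>
    (integrableOn_truncExp_exp hq0 hq1 hr hs ha t k).mul_const _
  have h := hasSum_integral_of_summable_integral_norm hint ?_
  · simp only [← exponentZ_eq, integral_mul_const] at h
    simpa only [mul_comm] using h
  · refine Summable.of_nonneg_of_le (fun k => by positivity)
      (fun k => integral_mono (hint k).norm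
        ((integrableOn_sq_add_sqrt_exp ha t).const_mul (p * weight q s k))
        fun u => norm_exponentZ_term_le hp hq0 hq1 hr hs k _) ?_
    simp only [integral_const_mul]
    exact ((summable_weight hq1).mul_left p).mul_right _

end Integrated

lemma integrableOn_truncExp_div {q r s : ℝ} (hq0 : 0 < q) (hq1 : q < 1) (hr : r = 1 / q)
    (hs : 0 < s) (t : ℝ) (k : ℤ) {x : ℝ} (hx : 0 < x) :
    IntegrableOn (fun y => truncExp k (t * y) / (y : ℂ)) (Set.Ioc 0 x) := by
  have hr0 : 0 < r := by rw [hr]; positivity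
  have hk : 0 < s * r ^ k := by positivity
  rw [integrableOn_Ioc_div_iff one_pos hx fun y => truncExp k (t * y)]
  refine (integrableOn_truncExp_exp hq0 hq1 hr hs one_pos (t * x / (s * r ^ k)) k).congr_fun
    (fun u _ => ?_) measurableSet_Ioi
  field_simp

/-! ### Identification of the integrated exponent with `g` -/

lemma integrandU_eq (q t : ℝ) (k : ℤ) (x : ℝ) :
    integrandU q t k x = (q ^ k : ℝ) * (truncExp k (t * x) / x) := by
  simp only [integrandU, truncExp, Complex.ofReal_mul, mul_assoc, mul_div_assoc]

section TermU

variable {q r s : ℝ} (hq0 : 0 < q) (hq1 : q < 1) (hr : r = 1 / q) (hs : 0 < s)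
include hq0 hq1 hr hs

lemma intervalIntegrable_truncExp_div (t : ℝ) (k : ℤ) {x : ℝ} (hx : 0 < x) :
    IntervalIntegrable (fun y => truncExp k (t * y) / (y : ℂ)) volume 0 x :=
  (intervalIntegrable_iff_integrableOn_Ioc_of_le hx.le).2
    (integrableOn_truncExp_div hq0 hq1 hr hs t k hx)

lemma intervalIntegrable_integrandU (t : ℝ) (k : ℤ) :
    IntervalIntegrable (integrandU q t k) volume (s * r ^ (k - 1)) (s * r ^ k) := by
  have hr0 : 0 < r := by rw [hr]; positivity
  simp only [funext (integrandU_eq q t k)]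
  exact ((intervalIntegrable_truncExp_div hq0 hq1 hr hs t k (by positivity)).symm.trans
    (intervalIntegrable_truncExp_div hq0 hq1 hr hs t k (by positivity))).const_mul _

/-- Only the passage from `c_{-1} = 1` to `c_0 = 0` changes the truncation. -/
lemma integral_truncExp_div_pred (t : ℝ) (k : ℤ) :
    ∫ y in (0 : ℝ)..(s * r ^ (k - 1)), truncExp k (t * y) / (y : ℂ) =
      (∫ y in (0 : ℝ)..(s * r ^ (k - 1)), truncExp (k - 1) (t * y) / (y : ℂ)) +
        if k = 0 then Complex.I * t * s * q else 0 := by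
  have hr0 : 0 < r := by rw [hr]; positivity
  split_ifs with hk
  · subst hk
    have hpos : 0 < s * r ^ ((0 : ℤ) - 1) := by positivity
    have hsq : s * r ^ ((0 : ℤ) - 1) = s * q := by rw [hr]; simp
    have hconst : ∫ _y in (0 : ℝ)..(s * r ^ ((0 : ℤ) - 1)), Complex.I * (t : ℂ) =
        Complex.I * t * s * q := by
      rw [intervalIntegral.integral_const, hsq, sub_zero, Complex.real_smul]; push_cast; ring
    rw [← hconst, ← intervalIntegral.integral_add
      (intervalIntegrable_truncExp_div hq0 hq1 hr hs t _ hpos) intervalIntegrable_const]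
    refine intervalIntegral.integral_congr_ae (Eventually.of_forall fun y hy => ?_)
    rw [Set.uIoc_of_le hpos.le] at hy
    have hy0 : (y : ℂ) ≠ 0 := Complex.ofReal_ne_zero.2 hy.1.ne'
    rw [truncExp_of_nonneg le_rfl, truncExp_of_neg (by norm_num)]
    push_cast
    field_simp
    ring
  · rw [add_zero]
    congr 1
    ext y
    rcases lt_or_ge k 0 with h | h
    · rw [truncExp_of_neg h, truncExp_of_neg (by omega)]
    · rw [truncExp_of_nonneg h, truncExp_of_nonneg (by omega)]

lemma termU_eq (t : ℝ) (k : ℤ) :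
    termU q r s t k =
      (q ^ k : ℝ) * (∫ y in (0 : ℝ)..(s * r ^ k), truncExp k (t * y) / (y : ℂ)) -
      (q ^ k : ℝ) * (∫ y in (0 : ℝ)..(s * r ^ (k - 1)), truncExp (k - 1) (t * y) / (y : ℂ)) -
      if k = 0 then Complex.I * t * s * q else 0 := by
  have hr0 : 0 < r := by rw [hr]; positivity
  have h := intervalIntegral.integral_interval_sub_left
    (intervalIntegrable_truncExp_div hq0 hq1 hr hs t k (show 0 < s * r ^ k by positivity))
    (intervalIntegrable_truncExp_div hq0 hq1 hr hs t k (show 0 < s * r ^ (k - 1) by positivity))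
  rw [termU, funext (integrandU_eq q t k), intervalIntegral.integral_const_mul, ← h,
    integral_truncExp_div_pred hq0 hq1 hr hs]
  split_ifs with hk
  · subst hk; simp; ring
  · ring

variable {p a : ℝ} (hp : 0 < p) (hq : q = 1 - p) (ha : 0 < a)
include hp hq ha

/-- Summation by parts: with `A_k = ∫_0^{s r^k} (e^{ity} - 1 - ity c_k) dy/y` the integrated exponent
of `Z` is `∑ p q^k A_k = ∑ (q^k - q^{k+1}) A_k = ∑ q^k (A_k - A_{k-1})`, up to the factor `a`. -/
lemma hasSum_termU (t : ℝ) :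
    HasSum (termU q r s t)
      (a * (∫ u in Set.Ioi (0 : ℝ), exponentZ p q r s (t * Real.exp (-a * u))) -
        Complex.I * t * s * q) := by
  have hr0 : 0 < r := by rw [hr]; positivity
  set W := ∫ u in Set.Ioi (0 : ℝ), exponentZ p q r s (t * Real.exp (-a * u)) with hW
  -- `h1` and `h2` are the two halves of the sum `∑ q^k (A_k - A_{k-1})`
  set A : ℤ → ℂ := fun k => ∫ y in (0 : ℝ)..(s * r ^ k), truncExp k (t * y) / (y : ℂ) with hA
  have hAeq : ∀ k, A k =
      a * ∫ u in Set.Ioi (0 : ℝ), truncExp k (t * Real.exp (-a * u) * (s * r ^ k)) := fun k => by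
    have hk : 0 < s * r ^ k := by positivity
    simp only [hA]
    rw [intervalIntegral.integral_of_le hk.le,
      integral_Ioc_div_eq ha hk fun y => truncExp k (t * y)]
    refine congrArg _ (integral_congr_ae (Eventually.of_forall fun u => ?_))
    exact congrArg (truncExp k) (by ring)
  have hpc : (p : ℂ) ≠ 0 := Complex.ofReal_ne_zero.2 hp.ne'
  have hqc : (q : ℂ) ≠ 0 := Complex.ofReal_ne_zero.2 hq0.ne'
  have h1 : HasSum (fun k : ℤ => (q ^ k : ℝ) * A k) (a / p * W) := by
    refine ((hasSum_integral_truncExp hq0 hq1 hr hs ha hp.le t).mul_left (a / p : ℂ)).congr_fun ?_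
    intro k
    rw [hAeq]
    generalize (∫ u in Set.Ioi (0 : ℝ), truncExp k (t * Real.exp (-a * u) * (s * r ^ k))) = B
    push_cast
    field_simp
  have h2 : HasSum (fun k : ℤ => (q ^ k : ℝ) * A (k - 1)) (q * (a / p * W)) := by
    refine (((Equiv.subRight (1 : ℤ)).hasSum_iff.2 h1).mul_left (q : ℂ)).congr_fun fun k => ?_
    simp only [Function.comp_apply, Equiv.subRight_apply]
    rw [zpow_sub_one₀ hq0.ne']
    push_cast
    field_simp
  have h3 : HasSum (fun k : ℤ => if k = 0 then Complex.I * t * s * q else 0)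
      (Complex.I * t * s * q) := hasSum_ite_eq 0 _
  have h := (h1.sub h2).sub h3
  rw [show (a / p * W - q * (a / p * W) : ℂ) = a * W by
    rw [hq]; push_cast; field_simp; ring] at h
  exact h.congr_fun fun k => termU_eq hq0 hq1 hr hs t k

lemma g_div_eq_integral (t : ℝ) :
    g q r s t / a = ∫ u in Set.Ioi (0 : ℝ), exponentZ p q r s (t * Real.exp (-a * u)) := by
  have hac : (a : ℂ) ≠ 0 := Complex.ofReal_ne_zero.2 ha.ne'
  rw [g, (hasSum_termU hq0 hq1 hr hs hp hq ha t).tsum_eq]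
  field_simp
  ring

end TermU

/-! ### The Lévy measure -/

/-- The part of the Lévy measure carried by `(s r^{k-1}, s r^k]`. -/
noncomputable def levyPiece (q r s a : ℝ) (k : ℤ) : Measure ℝ :=
  (volume.restrict (Set.Ioc (s * r ^ (k - 1)) (s * r ^ k))).withDensity
    fun y => ENNReal.ofReal (q ^ k / (a * y))

lemma levyMeasureU_eq_sum (q r s a : ℝ) :
    levyMeasureU q r s a = Measure.sum (levyPiece q r s a) := by
  have hm : ∀ k : ℤ, Measurable fun y : ℝ => ENNReal.ofReal (q ^ k / (a * y)) := fun k => by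
    fun_prop
  have h := withDensity_tsum (μ := (volume : Measure ℝ)) (f := fun k : ℤ =>
    (Set.Ioc (s * r ^ (k - 1)) (s * r ^ k)).indicator fun y => ENNReal.ofReal (q ^ k / (a * y)))
    fun k => (hm k).indicator measurableSet_Ioc
  simp only [withDensity_indicator measurableSet_Ioc] at h
  rw [levyMeasureU, ← funext fun _ => tsum_apply (Pi.summable.2 fun _ => ENNReal.summable), h]
  rfl

lemma levyMeasureU_singleton_zero (q r s a : ℝ) : levyMeasureU q r s a {0} = 0 :=
  withDensity_absolutelyContinuous _ _ Real.volume_singleton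

section Levy

variable {q r s a : ℝ} (hq0 : 0 < q) (hq1 : q < 1) (hr : r = 1 / q) (hs : 0 < s) (ha : 0 < a)
include hq0 hq1 hr hs ha

/-- On the piece with index `k` the density is at most `q^k r / (a s r^k)` and the length of the interval
at most `s r^k`; `min 1 x²` gains a factor `r^{2k} = q^{-2k}` when `k ≤ 0`. -/
lemma lintegral_levyPiece_le (k : ℤ) :
    ∫⁻ x, ENNReal.ofReal (min 1 (x ^ 2)) ∂levyPiece q r s a k ≤
      ENNReal.ofReal (r / a * (1 + s ^ 2) * q ^ k.natAbs) := by
  have hr0 : 0 < r := by rw [hr]; positivity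
  have hk : 0 < s * r ^ k := by positivity
  have hk1 : s * r ^ (k - 1) = s * r ^ k / r := by rw [zpow_sub_one₀ hr0.ne']; ring
  have hqr := zpow_mul_zpow_eq_one hq0 hr k
  have hmin : q ^ k * min 1 ((s * r ^ k) ^ 2) ≤ (1 + s ^ 2) * q ^ k.natAbs := by
    rcases le_total 0 k with h | h
    · obtain ⟨n, rfl⟩ : ∃ n : ℕ, k = n := ⟨k.natAbs, by omega⟩
      simp only [zpow_natCast, Int.natAbs_natCast]
      have : (0 : ℝ) < q ^ n := by positivity
      nlinarith [min_le_left 1 ((s * r ^ n) ^ 2), mul_nonneg (sq_nonneg s) this.le]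
    · obtain ⟨n, rfl⟩ : ∃ n : ℕ, k = -n := ⟨k.natAbs, by omega⟩
      have hrn : r ^ (-(n : ℤ)) = q ^ n := by rw [hr, zpow_neg, zpow_natCast]; simp
      have : (0 : ℝ) < q ^ n := by positivity
      calc q ^ (-(n : ℤ)) * min 1 ((s * r ^ (-(n : ℤ))) ^ 2)
          ≤ q ^ (-(n : ℤ)) * (s * r ^ (-(n : ℤ))) ^ 2 := by gcongr; exact min_le_right _ _
        _ = (q ^ (-(n : ℤ)) * r ^ (-(n : ℤ))) * s ^ 2 * r ^ (-(n : ℤ)) := by ring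
        _ = s ^ 2 * q ^ n := by rw [hqr, hrn]; ring
        _ ≤ (1 + s ^ 2) * q ^ n := by nlinarith
        _ = _ := by simp
  rw [levyPiece, lintegral_withDensity_eq_lintegral_mul _ (by fun_prop) (by fun_prop)]
  calc ∫⁻ y in Set.Ioc (s * r ^ (k - 1)) (s * r ^ k), _
      ≤ ∫⁻ _ in Set.Ioc (s * r ^ (k - 1)) (s * r ^ k),
          ENNReal.ofReal (q ^ k * min 1 ((s * r ^ k) ^ 2) / (a * (s * r ^ k / r))) := by
        refine setLIntegral_mono measurable_const fun y hy => ?_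
        have hy0 : 0 < y := lt_trans (by positivity) hy.1
        rw [Pi.mul_apply, ← ENNReal.ofReal_mul (by positivity)]
        refine ENNReal.ofReal_le_ofReal ?_
        rw [div_mul_eq_mul_div]
        have := hy.1.le
        rw [hk1] at this
        have h2 : y ^ 2 ≤ (s * r ^ k) ^ 2 := pow_le_pow_left₀ hy0.le hy.2 2
        gcongr
    _ ≤ ENNReal.ofReal (q ^ k * min 1 ((s * r ^ k) ^ 2) / (a * (s * r ^ k / r))) *
          ENNReal.ofReal (s * r ^ k) := by
        rw [setLIntegral_const, Real.volume_Ioc]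
        gcongr
        have : 0 < s * r ^ (k - 1) := by positivity
        linarith
    _ = ENNReal.ofReal (r / a * (q ^ k * min 1 ((s * r ^ k) ^ 2))) := by
        rw [← ENNReal.ofReal_mul (by positivity)]
        congr 1
        field_simp
    _ ≤ _ := by
        refine ENNReal.ofReal_le_ofReal ?_
        rw [mul_assoc (r / a)]
        gcongr

lemma lintegral_levyMeasureU_lt_top :
    ∫⁻ x, ENNReal.ofReal (min 1 (x ^ 2)) ∂levyMeasureU q r s a < ∞ := by
  have hr0 : 0 < r := by rw [hr]; positivity
  have hsum : Summable fun k : ℤ => r / a * (1 + s ^ 2) * q ^ k.natAbs :=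
    (summable_pow_natAbs hq0.le hq1).mul_left _
  rw [levyMeasureU_eq_sum, lintegral_sum_measure]
  refine (ENNReal.tsum_le_tsum fun k => lintegral_levyPiece_le hq0 hq1 hr hs ha k).trans_lt ?_
  rw [← ENNReal.ofReal_tsum_of_nonneg (fun k => by positivity) hsum]
  exact ENNReal.ofReal_lt_top

lemma integrable_levyMeasureU {E : Type*} [NormedAddCommGroup E] {F : ℝ → E}
    (hF : AEStronglyMeasurable F (levyMeasureU q r s a)) (C : ℝ)
    (hC : ∀ x, ‖F x‖ ≤ C * min 1 (x ^ 2)) : Integrable F (levyMeasureU q r s a) := by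
  have hmin : Integrable (fun x : ℝ => min 1 (x ^ 2)) (levyMeasureU q r s a) := by
    refine ⟨(by fun_prop : Measurable fun x : ℝ => min 1 (x ^ 2)).aestronglyMeasurable, ?_⟩
    rw [hasFiniteIntegral_iff_ofReal (Eventually.of_forall fun x => by positivity)]
    exact lintegral_levyMeasureU_lt_top hq0 hq1 hr hs ha
  exact (hmin.const_mul C).mono' hF (Eventually.of_forall hC)

end Levy

/-- The integrand of the Lévy–Khintchine formula for the truncation function `1_{|x| ≤ ρ}`. -/
noncomputable def levyIntegrand (ρ t x : ℝ) : ℂ :=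
  Complex.exp (Complex.I * t * x) - 1 - Complex.I * t * x * (if |x| ≤ ρ then 1 else 0)

lemma measurable_levyIntegrand (ρ t : ℝ) : Measurable (levyIntegrand ρ t) := by
  unfold levyIntegrand
  have : Measurable fun x : ℝ => (if |x| ≤ ρ then 1 else 0 : ℂ) :=
    Measurable.ite (measurableSet_le measurable_norm measurable_const)
      measurable_const measurable_const
  fun_prop

lemma sq_le_mul_min {ρ x : ℝ} (hx : |x| ≤ ρ) : x ^ 2 ≤ (1 + ρ ^ 2) * min 1 (x ^ 2) := by
  have h : x ^ 2 ≤ ρ ^ 2 := by rw [← sq_abs]; exact pow_le_pow_left₀ (abs_nonneg x) hx 2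
  rcases le_total 1 (x ^ 2) with h1 | h1
  · rw [min_eq_left h1]; linarith
  · rw [min_eq_right h1]; nlinarith [sq_nonneg x, sq_nonneg ρ]

lemma one_le_mul_min {ρ x : ℝ} (hρ : 0 < ρ) (hx : ρ ≤ |x|) :
    1 ≤ (1 + 1 / ρ ^ 2) * min 1 (x ^ 2) := by
  have h : ρ ^ 2 ≤ x ^ 2 := by rw [← sq_abs x]; exact pow_le_pow_left₀ hρ.le hx 2
  have h0 : 0 < ρ ^ 2 := by positivity
  have h2 : 0 < 1 / ρ ^ 2 := by positivity
  rcases le_total 1 (x ^ 2) with h1 | h1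
  · rw [min_eq_left h1]; linarith
  · rw [min_eq_right h1]
    have : 1 ≤ 1 / ρ ^ 2 * x ^ 2 := by rw [one_div, inv_mul_eq_div, le_div_iff₀ h0]; linarith
    nlinarith [sq_nonneg x]

lemma norm_levyIntegrand_le {ρ : ℝ} (hρ : 0 < ρ) (t x : ℝ) :
    ‖levyIntegrand ρ t x‖ ≤
      (3 * t ^ 2 * (1 + ρ ^ 2) + 2 * (1 + 1 / ρ ^ 2)) * min 1 (x ^ 2) := by
  have hm : 0 ≤ min 1 (x ^ 2) := by positivity
  have hi : (0 : ℝ) ≤ 1 / ρ ^ 2 := by positivity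
  rw [levyIntegrand, mul_assoc Complex.I, ← Complex.ofReal_mul, add_mul]
  split_ifs with h
  · rw [mul_one]
    have h1 := norm_cexp_sub_one_sub_le_sq (t * x)
    have h2 := mul_le_mul_of_nonneg_left (sq_le_mul_min h) (show 0 ≤ 3 * t ^ 2 by positivity)
    have h3 : 0 ≤ 2 * (1 + 1 / ρ ^ 2) * min 1 (x ^ 2) := by positivity
    nlinarith
  · rw [mul_zero, sub_zero]
    have h1 : ‖Complex.exp (Complex.I * (t * x : ℝ)) - 1‖ ≤ 2 := by
      refine (norm_sub_le _ _).trans ?_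
      rw [Complex.norm_exp_I_mul_ofReal, norm_one]; norm_num
    have h2 := one_le_mul_min hρ (not_le.1 h).le
    have h3 : 0 ≤ 3 * t ^ 2 * (1 + ρ ^ 2) * min 1 (x ^ 2) := by positivity
    linarith

/-- The difference of the two truncated linear terms is bounded and vanishes near `0`. -/
lemma abs_truncation_sub_le {ρ : ℝ} (hρ : 0 < ρ) (x : ℝ) :
    |x * ((if |x| ≤ 1 then 1 else 0) - if |x| ≤ ρ then 1 else 0)| ≤
      (1 + ρ) * (1 + (1 + 1 / ρ ^ 2)) * min 1 (x ^ 2) := by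
  have hm : 0 ≤ min 1 (x ^ 2) := by positivity
  have hi : (0 : ℝ) ≤ 1 / ρ ^ 2 := by positivity
  have h0 : 0 ≤ (1 + ρ) * (1 + (1 + 1 / ρ ^ 2)) * min 1 (x ^ 2) := by positivity
  split_ifs with h1 h2 h2
  · simpa using h0
  · have := one_le_mul_min hρ (not_le.1 h2).le
    rw [sub_zero, mul_one]
    nlinarith
  · have := one_le_mul_min one_pos (not_le.1 h1).le
    rw [zero_sub, mul_neg, mul_one, abs_neg]
    have h3 : 1 ≤ min 1 (x ^ 2) := by
      refine le_min le_rfl ?_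
      rw [← sq_abs]; nlinarith [not_le.1 h1]
    have h4 : 1 ≤ (1 + (1 + 1 / ρ ^ 2)) * min 1 (x ^ 2) := by nlinarith
    nlinarith
  · simpa using h0

section Levy

variable {q r s a : ℝ} (hq0 : 0 < q) (hq1 : q < 1) (hr : r = 1 / q) (hs : 0 < s) (ha : 0 < a)
include hq0 hq1 hr hs ha

/-- The convention `c_k = 1_{k < 0}` is truncation at `|x| ≤ s q`, the right end of the interval with
index `-1`. -/
lemma integral_levyPiece (t : ℝ) (k : ℤ) :
    ∫ x, levyIntegrand (s * q) t x ∂levyPiece q r s a k = termU q r s t k / a := by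
  have hr0 : 0 < r := by rw [hr]; positivity
  have hr1 : 1 ≤ r := by rw [hr, le_div_iff₀ hq0]; linarith
  have hle : s * r ^ (k - 1) ≤ s * r ^ k := by
    gcongr
    linarith
  have hrq : r ^ (-1 : ℤ) = q := by rw [hr]; simp
  have hlow : 0 < s * r ^ (k - 1) := by positivity
  rw [levyPiece, integral_withDensity_eq_integral_toReal_smul (by fun_prop)
    (Eventually.of_forall fun _ => ENNReal.ofReal_lt_top), termU,
    intervalIntegral.integral_of_le hle, ← integral_div]
  refine setIntegral_congr_fun measurableSet_Ioc fun y hy => ?_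
  have hy0 : 0 < y := hlow.trans hy.1
  have hc : (if |y| ≤ s * q then 1 else 0 : ℂ) = c k := by
    rw [abs_of_pos hy0, c]
    rcases lt_or_ge k 0 with hk | hk
    · have : y ≤ s * q := by
        rw [← hrq]
        refine hy.2.trans ?_
        gcongr
        omega
      simp [hk, this]
    · have : s * q < y := by
        rw [← hrq]
        refine lt_of_le_of_lt ?_ hy.1
        gcongr
        omega
      simp [not_lt.2 hk, not_le.2 this]
  rw [ENNReal.toReal_ofReal (by positivity), Complex.real_smul, levyIntegrand, hc, integrandU]
  push_cast
  field_simp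

lemma integrable_levyIntegrand {ρ : ℝ} (hρ : 0 < ρ) (t : ℝ) :
    Integrable (levyIntegrand ρ t) (levyMeasureU q r s a) :=
  integrable_levyMeasureU hq0 hq1 hr hs ha (measurable_levyIntegrand ρ t).aestronglyMeasurable _
    (norm_levyIntegrand_le hρ t)

/-- The Lévy–Khintchine representation of `g / a`. There is no Gaussian part. -/
theorem isLevyExponent_g_div :
    IsLevyExponent (fun t => g q r s t / a) (levyMeasureU q r s a) := by
  have hρ : 0 < s * q := by positivity
  set τ : ℝ → ℝ := fun x => x * ((if |x| ≤ 1 then 1 else 0) - if |x| ≤ s * q then 1 else 0)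
    with hτ
  have hτm : Measurable τ := by
    have hm : ∀ ρ : ℝ, Measurable fun x : ℝ => (if |x| ≤ ρ then 1 else 0 : ℝ) := fun ρ =>
      Measurable.ite (measurableSet_le measurable_norm measurable_const)
        measurable_const measurable_const
    exact measurable_id.mul ((hm 1).sub (hm _))
  have hτi : Integrable τ (levyMeasureU q r s a) :=
    integrable_levyMeasureU hq0 hq1 hr hs ha hτm.aestronglyMeasurable _ (abs_truncation_sub_le hρ)
  -- the drift `s q / a` of `g / a` is corrected by the change of truncation, from `s q` to `1`
  refine ⟨levyMeasureU_singleton_zero q r s a, lintegral_levyMeasureU_lt_top hq0 hq1 hr hs ha,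
    s * q / a + ∫ x, τ x ∂levyMeasureU q r s a, 0, fun t => ?_⟩
  have hac : (a : ℂ) ≠ 0 := Complex.ofReal_ne_zero.2 ha.ne'
  have hint := integrable_levyIntegrand hq0 hq1 hr hs ha hρ t
  have hsum : HasSum (fun k => termU q r s t k / a)
      (∫ x, levyIntegrand (s * q) t x ∂levyMeasureU q r s a) := by
    rw [levyMeasureU_eq_sum] at hint ⊢
    exact (hasSum_integral_measure hint).congr_fun fun k =>
      (integral_levyPiece hq0 hq1 hr hs ha t k).symm
  have hτc : Integrable (fun x => (τ x : ℂ)) (levyMeasureU q r s a) := hτi.ofReal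
  have hsplit : ∫ x, levyIntegrand (s * q) t x ∂levyMeasureU q r s a =
      ∫ x, levyIntegrand 1 t x ∂levyMeasureU q r s a +
        Complex.I * t * ∫ x, τ x ∂levyMeasureU q r s a := by
    rw [← integral_complex_ofReal, ← integral_const_mul,
      ← integral_add (integrable_levyIntegrand hq0 hq1 hr hs ha one_pos t)
        (hτc.const_mul _)]
    refine integral_congr_ae (Eventually.of_forall fun x => ?_)
    simp only [levyIntegrand, hτ]
    push_cast [apply_ite (Complex.ofReal)]
    ring
  have hg : g q r s t = Complex.I * t * s * q +
      a * ∫ x, levyIntegrand (s * q) t x ∂levyMeasureU q r s a := by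
    rw [g, ← hsum.tsum_eq, tsum_div_const]
    field_simp
  change g q r s t / a = _ + ∫ x, levyIntegrand 1 t x ∂levyMeasureU q r s a
  rw [hg, hsplit]
  push_cast
  field_simp
  simp
  ring

end Levy

/-! ### Tagged partitions -/

namespace TaggedPartition

variable {T : ℝ≥0} (π : TaggedPartition T)

lemma pts_mono {i j : ℕ} (hij : i ≤ j) (hj : j ≤ π.n) : π.pts i ≤ π.pts j := by
  induction j, hij using Nat.le_induction with
  | base => exact le_rfl
  | succ j _ ih => exact (ih (by omega)).trans (π.pts_le j (by omega))

lemma MeshLE.mono {π : TaggedPartition T} {η η' : ℝ} (h : π.MeshLE η) (hη : η ≤ η') :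
    π.MeshLE η' := fun i hi => (h i hi).trans hη

lemma exists_meshLE (T : ℝ≥0) {η : ℝ} (hη : 0 < η) : ∃ π : TaggedPartition T, π.MeshLE η := by
  obtain ⟨m, hm⟩ := exists_nat_gt ((T : ℝ) / η)
  have hpts : ∀ i : ℕ, T * i / (m + 1 : ℝ≥0) ≤ T * (i + 1 : ℕ) / (m + 1 : ℝ≥0) := fun i => by
    gcongr; omega
  refine ⟨⟨m + 1, fun i => T * i / (m + 1 : ℝ≥0), fun i => T * i / (m + 1 : ℝ≥0), by simp, ?_,
    fun i _ => hpts i, fun i _ => ⟨le_rfl, hpts i⟩⟩, fun i _ => ?_⟩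
  · push_cast
    field_simp
  · have hm' : (T : ℝ) ≤ η * (m + 1) := by
      rw [div_lt_iff₀ hη] at hm; nlinarith
    push_cast
    rw [← sub_div, div_le_iff₀ (by positivity)]
    linarith

/-- The step function equal to `f (tags i)` on `(pts i, pts (i+1)]`. -/
noncomputable def step (f : ℝ → ℝ) (x : ℝ) : ℝ :=
  stepFun (Finset.range π.n) (fun i => f (π.tags i)) π.pts (fun i => π.pts (i + 1)) x

lemma step_of_notMem (f : ℝ → ℝ) {x : ℝ} (hx : x ∉ Set.Ioc (0 : ℝ) T) : π.step f x = 0 := by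
  rw [step, stepFun]
  refine Finset.sum_eq_zero fun i hi => Set.indicator_of_notMem (fun hm => hx ⟨?_, ?_⟩) _
  · exact (π.pts i).2.trans_lt hm.1
  · refine hm.2.trans (NNReal.coe_le_coe.2 ?_)
    exact (π.pts_mono (Finset.mem_range.1 hi) le_rfl).trans_eq π.pts_last

lemma exists_step_eq (f : ℝ → ℝ) {x : ℝ} (hx : x ∈ Set.Ioc (0 : ℝ) T) :
    ∃ i < π.n, x ∈ Set.Ioc (π.pts i : ℝ) (π.pts (i + 1)) ∧ π.step f x = f (π.tags i) := by
  classical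
  have hex : ∃ m, x ≤ π.pts m := ⟨π.n, by rw [π.pts_last]; exact hx.2⟩
  have hn : Nat.find hex ≤ π.n := Nat.find_min' hex (by rw [π.pts_last]; exact hx.2)
  obtain ⟨i, hi⟩ : ∃ i, Nat.find hex = i + 1 := Nat.exists_eq_succ_of_ne_zero fun h0 => by
    have := Nat.find_spec hex
    rw [h0, π.pts_zero] at this
    exact absurd hx.1 (not_lt.2 this)
  have hxi : x ∈ Set.Ioc (π.pts i : ℝ) (π.pts (i + 1)) :=
    ⟨not_le.1 (Nat.find_min hex (by omega)), hi ▸ Nat.find_spec hex⟩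
  refine ⟨i, by omega, hxi, ?_⟩
  rw [step, stepFun, Finset.sum_eq_single_of_mem i (Finset.mem_range.2 (by omega)),
    Set.indicator_of_mem hxi]
  intro j hj hji
  rw [Finset.mem_range] at hj
  refine Set.indicator_of_notMem (fun hm => ?_) _
  rcases lt_or_gt_of_ne hji with h | h
  · exact absurd (hxi.1.trans_le hm.2)
      (not_lt.2 (NNReal.coe_le_coe.2 (π.pts_mono (show j + 1 ≤ i by omega) (by omega))))
  · exact absurd (hm.1.trans_le hxi.2)
      (not_lt.2 (NNReal.coe_le_coe.2 (π.pts_mono (show i + 1 ≤ j by omega) (by omega))))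

/-- The step function evaluates `f` within the mesh of the given point. -/
lemma exists_step_eq_of_meshLE (f : ℝ → ℝ) {η x : ℝ} (hπ : π.MeshLE η)
    (hx : x ∈ Set.Ioc (0 : ℝ) T) : ∃ y, 0 ≤ y ∧ |y - x| ≤ η ∧ π.step f x = f y := by
  obtain ⟨i, hi, hxi, h⟩ := π.exists_step_eq f hx
  have htag := π.tags_mem i hi
  have h1 : (π.pts i : ℝ) ≤ π.tags i := NNReal.coe_le_coe.2 htag.1
  have h2 : (π.tags i : ℝ) ≤ π.pts (i + 1) := NNReal.coe_le_coe.2 htag.2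
  have h3 := hπ i hi
  exact ⟨π.tags i, (π.tags i).2, abs_le.2 ⟨by linarith [hxi.2], by linarith [hxi.1]⟩, h⟩

lemma measurable_step (f : ℝ → ℝ) : Measurable (π.step f) := measurable_stepFun _ _ _ _

end TaggedPartition

/-- A common majorant for all partitions of mesh at most `1`; it holds for all real `x`, the step
function being `0` outside `(0, T]`. -/
lemma abs_step_exp_le {T : ℝ≥0} (π : TaggedPartition T) {a η : ℝ} (ha : 0 < a)
    (hπ : π.MeshLE η) (hη : η ≤ 1) (x : ℝ) :
    0 ≤ π.step (fun u => Real.exp (-a * u)) x ∧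
      π.step (fun u => Real.exp (-a * u)) x ≤ Real.exp a * Real.exp (-a * x) := by
  by_cases hx : x ∈ Set.Ioc (0 : ℝ) T
  · obtain ⟨y, -, hyx, h⟩ := π.exists_step_eq_of_meshLE (fun u => Real.exp (-a * u)) hπ hx
    rw [h]
    refine ⟨(Real.exp_pos _).le, ?_⟩
    rw [← Real.exp_add]
    refine Real.exp_le_exp.2 ?_
    nlinarith [(abs_le.1 (hyx.trans hη)).1]
  · rw [π.step_of_notMem _ hx]
    exact ⟨le_rfl, by positivity⟩

lemma tendsto_step {f : ℝ → ℝ} (hf : Continuous f) {T : ℕ → ℝ≥0} (π : ∀ n, TaggedPartition (T n))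
    (hπ : ∀ n, (π n).MeshLE (1 / ((n : ℝ) + 1))) {x : ℝ}
    (hx : ∀ᶠ n in atTop, x ∈ Set.Ioc (0 : ℝ) (T n)) :
    Tendsto (fun n => (π n).step f x) atTop (𝓝 (f x)) := by
  rw [Metric.tendsto_atTop']
  intro ε hε
  obtain ⟨δ, hδ, hfδ⟩ := Metric.continuous_iff.1 hf x ε hε
  obtain ⟨N, hN⟩ := eventually_atTop.1
    (hx.and (tendsto_one_div_add_atTop_nhds_zero_nat.eventually_lt_const hδ))
  refine ⟨N, fun n hn => ?_⟩
  obtain ⟨hxn, hn2⟩ := hN n hn.le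
  obtain ⟨y, -, hyx, h⟩ := (π n).exists_step_eq_of_meshLE f (hπ n) hxn
  rw [h]
  exact hfδ y (by rw [Real.dist_eq]; exact hyx.trans_lt hn2)

/-! ### The integral of `e^{-au}` -/

/-- Dominated convergence for the exponents of step functions approximating `e^{-ax}`. -/
lemma tendsto_integral_exponent {ψ : ℝ → ℂ} (hψc : Continuous ψ) (hψ0 : ψ 0 = 0) {C : ℝ}
    (hC0 : 0 ≤ C) (hC : ∀ y, ‖ψ y‖ ≤ C * (y ^ 2 + √|y|)) {a : ℝ} (ha : 0 < a) (t : ℝ)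
    {h : ℕ → ℝ → ℝ} {h' : ℝ → ℝ} (hm : ∀ n, Measurable (h n))
    (hneg : ∀ n, ∀ x ≤ 0, h n x = 0)
    (hbd : ∀ n x, |h n x| ≤ Real.exp a * Real.exp (-a * x))
    (hlim : ∀ x > 0, Tendsto (fun n => h n x) atTop (𝓝 (h' x))) :
    Tendsto (fun n => ∫ x, ψ (t * h n x)) atTop (𝓝 (∫ x in Set.Ioi 0, ψ (t * h' x))) := by
  have hset : ∀ n, ∫ x, ψ (t * h n x) = ∫ x in Set.Ioi 0, ψ (t * h n x) := fun n =>
    (setIntegral_eq_integral_of_forall_compl_eq_zero fun x hx => by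
      rw [hneg n x (not_lt.1 hx), mul_zero, hψ0]).symm
  simp only [hset]
  refine tendsto_integral_of_dominated_convergence _
    (fun n => (hψc.measurable.comp ((hm n).const_mul t)).aestronglyMeasurable)
    ((integrableOn_sq_add_sqrt_exp ha (t * Real.exp a)).const_mul C)
    (fun n => Eventually.of_forall fun x => ?_) ?_
  · refine (hC _).trans (mul_le_mul_of_nonneg_left ?_ hC0)
    have h1 : |t * h n x| ≤ |t * Real.exp a * Real.exp (-a * x)| := by
      rw [mul_assoc, abs_mul, abs_mul t]
      exact mul_le_mul_of_nonneg_left ((hbd n x).trans (le_abs_self _)) (abs_nonneg t)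
    exact add_le_add (sq_le_sq.2 h1) (Real.sqrt_le_sqrt h1)
  · filter_upwards [ae_restrict_mem measurableSet_Ioi] with x hx
    exact (hψc.tendsto _).comp ((hlim x hx).const_mul t)

section Integral

variable {Ω : Type*} [MeasurableSpace Ω] {P : Measure Ω}

lemma measurable_riemannSum {Z : ℝ≥0 → Ω → ℝ} (hZ : ∀ u, Measurable (Z u)) (f : ℝ → ℝ) {T : ℝ≥0}
    (π : TaggedPartition T) : Measurable (riemannSum f Z π) :=
  Finset.measurable_fun_sum _ fun _ _ => ((hZ _).sub (hZ _)).const_mul _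

variable {Z : ℝ≥0 → Ω → ℝ} (hZ : IsLevyProcess Z P) {ψ : ℝ → ℂ}
  (hψ : ∀ (u : ℝ≥0) (t : ℝ), charFun (P.map (Z u)) t = Complex.exp ((u : ℝ) * ψ t))
  (hψ0 : ψ 0 = 0)
include hZ hψ hψ0

lemma charFun_riemannSum (f : ℝ → ℝ) {T : ℝ≥0} (π : TaggedPartition T) (t : ℝ) :
    charFun (P.map (riemannSum f Z π)) t = Complex.exp (∫ x, ψ (t * π.step f x)) :=
  charFun_stepIntegral Z hZ hψ0 hψ (Finset.range π.n) (fun i => f (π.tags i)) π.pts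
    (fun i => π.pts (i + 1)) (fun i hi => π.pts_le i (Finset.mem_range.1 hi)) t

/-- The difference of two Riemann–Stieltjes sums is again the integral of a step function. -/
lemma charFun_riemannSum_sub (f : ℝ → ℝ) {T T' : ℝ≥0} (π : TaggedPartition T)
    (π' : TaggedPartition T') (t : ℝ) :
    charFun (P.map (fun ω => riemannSum f Z π ω - riemannSum f Z π' ω)) t =
      Complex.exp (∫ x, ψ (t * (π.step f x - π'.step f x))) := by
  have h := charFun_stepIntegral Z hZ hψ0 hψ
    ((Finset.range π.n).disjSum (Finset.range π'.n))
    (Sum.elim (fun i => f (π.tags i)) fun i => -f (π'.tags i)) (Sum.elim π.pts π'.pts)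
    (Sum.elim (fun i => π.pts (i + 1)) fun i => π'.pts (i + 1)) (by
      rintro (i | i) hi
      · exact π.pts_le i (by simpa using hi)
      · exact π'.pts_le i (by simpa using hi)) t
  convert h using 4 with ω x
  · simp [stepIntegral, riemannSum, Finset.sum_disjSum, sub_eq_add_neg]
  · exact congrArg (fun y => ψ (t * y)) (stepFun_disjSum _ _ _ _ _ _ _ _ x).symm

variable [IsProbabilityMeasure P] (hψc : Continuous ψ) {C : ℝ} (hC0 : 0 ≤ C)
  (hC : ∀ y, ‖ψ y‖ ≤ C * (y ^ 2 + √|y|)) {a : ℝ} (ha : 0 < a)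
include hψc hC0 hC ha

/-- If the step functions of two sequences of partitions, possibly of different intervals, merge
pointwise, then the Riemann–Stieltjes sums merge in probability. -/
lemma tendsto_measure_riemannSum_sub {T T' : ℕ → ℝ≥0} (π : ∀ n, TaggedPartition (T n))
    (π' : ∀ n, TaggedPartition (T' n)) (hπ : ∀ n, (π n).MeshLE (1 / ((n : ℝ) + 1)))
    (hπ' : ∀ n, (π' n).MeshLE (1 / ((n : ℝ) + 1)))
    (hd : ∀ x > 0, Tendsto (fun n => (π n).step (fun u => Real.exp (-a * u)) x -
      (π' n).step (fun u => Real.exp (-a * u)) x) atTop (𝓝 0)) {ε : ℝ} (hε : 0 < ε) :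
    Tendsto (fun n => P {ω | ε ≤ |riemannSum (fun u => Real.exp (-a * u)) Z (π n) ω -
      riemannSum (fun u => Real.exp (-a * u)) Z (π' n) ω|}) atTop (𝓝 0) := by
  have hη : ∀ n : ℕ, 1 / ((n : ℝ) + 1) ≤ 1 := fun n =>
    (div_le_one (by positivity)).2 (by linarith [n.cast_nonneg (α := ℝ)])
  refine tendsto_measure_of_tendsto_charFun_one
    (fun n ω => riemannSum (fun u => Real.exp (-a * u)) Z (π n) ω -
      riemannSum (fun u => Real.exp (-a * u)) Z (π' n) ω) (fun n =>
    (measurable_riemannSum hZ.measurable _ _).sub (measurable_riemannSum hZ.measurable _ _))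
    (fun t => ?_) ε hε
  simp only [charFun_riemannSum_sub hZ hψ hψ0]
  have h := tendsto_integral_exponent hψc hψ0 hC0 hC ha t (h' := fun _ => 0)
    (h := fun n x => (π n).step (fun u => Real.exp (-a * u)) x -
      (π' n).step (fun u => Real.exp (-a * u)) x)
    (fun n => ((π n).measurable_step fun u => Real.exp (-a * u)).sub
      ((π' n).measurable_step fun u => Real.exp (-a * u)))
    (fun n x hx => ?_) (fun n x => ?_) hd
  · simp only [mul_zero, hψ0, integral_zero] at h
    simpa [Function.comp_def] using (Complex.continuous_exp.tendsto _).comp h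
  · have hx' : ∀ S : ℝ≥0, x ∉ Set.Ioc (0 : ℝ) S := fun S hm => absurd hm.1 (not_lt.2 hx)
    simp [(π n).step_of_notMem _ (hx' _), (π' n).step_of_notMem _ (hx' _)]
  · obtain ⟨h1, h2⟩ := abs_step_exp_le (π n) ha (hπ n) (hη n) x
    obtain ⟨h3, h4⟩ := abs_step_exp_le (π' n) ha (hπ' n) (hη n) x
    exact abs_le.2 ⟨by linarith, by linarith⟩

/-- Riemann–Stieltjes sums over `[0, T]` are Cauchy in probability as the mesh tends to `0`. -/
lemma exists_mesh_riemannSum_sub (T : ℝ≥0) {ε : ℝ} (hε : 0 < ε) {δ : ℝ≥0∞} (hδ : 0 < δ) :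
    ∃ η : ℝ, 0 < η ∧ ∀ π π' : TaggedPartition T, π.MeshLE η → π'.MeshLE η →
      P {ω | ε ≤ |riemannSum (fun u => Real.exp (-a * u)) Z π ω -
        riemannSum (fun u => Real.exp (-a * u)) Z π' ω|} ≤ δ := by
  by_contra! hcon
  -- otherwise counterexamples of mesh `1 / (n + 1)` contradict dominated convergence
  choose π π' hπ hπ' hlt using fun n : ℕ => hcon (1 / ((n : ℝ) + 1)) (by positivity)
  have h := tendsto_measure_riemannSum_sub hZ hψ hψ0 hψc hC0 hC ha π π' hπ hπ'
    (fun x hx => ?_) hε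
  · obtain ⟨n, hn⟩ := (ENNReal.tendsto_nhds_zero.1 h δ hδ).exists
    exact absurd hn (not_le.2 (hlt n))
  · by_cases hxT : x ∈ Set.Ioc (0 : ℝ) T
    · have hf : Continuous fun u => Real.exp (-a * u) := by fun_prop
      simpa using (tendsto_step hf π hπ (Eventually.of_forall fun _ => hxT)).sub
        (tendsto_step hf π' hπ' (Eventually.of_forall fun _ => hxT))
    · simp [TaggedPartition.step_of_notMem _ _ hxT]

/-- Riemann–Stieltjes sums over `[0, T]` and `[0, T']` are close in probability when the mesh is
small and `T`, `T'` are large. -/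
lemma exists_mesh_riemannSum_sub_of_large {ε : ℝ} (hε : 0 < ε) {δ : ℝ≥0∞} (hδ : 0 < δ) :
    ∃ η : ℝ, 0 < η ∧ ∃ N : ℕ, ∀ T T' : ℝ≥0, N ≤ T → N ≤ T' → ∀ (π : TaggedPartition T)
      (π' : TaggedPartition T'), π.MeshLE η → π'.MeshLE η →
      P {ω | ε ≤ |riemannSum (fun u => Real.exp (-a * u)) Z π ω -
        riemannSum (fun u => Real.exp (-a * u)) Z π' ω|} ≤ δ := by
  by_contra! hcon
  choose T T' hT hT' π π' hπ hπ' hlt using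
    fun n : ℕ => hcon (1 / ((n : ℝ) + 1)) (by positivity) n
  have hmem : ∀ S : ℕ → ℝ≥0, (∀ n : ℕ, (n : ℝ≥0) ≤ S n) → ∀ x > 0,
      ∀ᶠ n in atTop, x ∈ Set.Ioc (0 : ℝ) (S n) := fun S hS x hx => by
    obtain ⟨n₀, hn₀⟩ := exists_nat_ge x
    filter_upwards [eventually_ge_atTop n₀] with n hn
    refine ⟨hx, hn₀.trans ((Nat.cast_le.2 hn).trans ?_)⟩
    exact_mod_cast NNReal.coe_le_coe.2 (hS n)
  have h := tendsto_measure_riemannSum_sub hZ hψ hψ0 hψc hC0 hC ha π π' hπ hπ'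
    (fun x hx => ?_) hε
  · obtain ⟨n, hn⟩ := (ENNReal.tendsto_nhds_zero.1 h δ hδ).exists
    exact absurd hn (not_le.2 (hlt n))
  · have hf : Continuous fun u => Real.exp (-a * u) := by fun_prop
    simpa using (tendsto_step hf π hπ (hmem T hT x hx)).sub
      (tendsto_step hf π' hπ' (hmem T' hT' x hx))

/-- Existence of `∫₀ᵀ e^{-au} dZ(u)`: the limit is found along one sequence of partitions, and the
Cauchy property extends the convergence to all partitions of small mesh. -/
lemma exists_isIntegral_exp (T : ℝ≥0) :
    ∃ Y : Ω → ℝ, Measurable Y ∧ IsIntegral (fun u => Real.exp (-a * u)) Z P T Y := by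
  choose π hπ using fun n : ℕ =>
    TaggedPartition.exists_meshLE T (show 0 < 1 / ((n : ℝ) + 1) by positivity)
  have hsmall : ∀ η : ℝ, 0 < η → ∃ N, ∀ n ≥ N, (π n).MeshLE η := fun η hη => by
    obtain ⟨N, hN⟩ := eventually_atTop.1
      (tendsto_one_div_add_atTop_nhds_zero_nat.eventually_lt_const hη)
    exact ⟨N, fun n hn => (hπ n).mono (hN n hn).le⟩
  obtain ⟨Y, hYm, hY⟩ := exists_tendsto_measure_of_cauchy
    (fun n => riemannSum (fun u => Real.exp (-a * u)) Z (π n))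
    (fun n => measurable_riemannSum hZ.measurable _ _) fun ε hε δ hδ => by
      obtain ⟨η, hη, h⟩ := exists_mesh_riemannSum_sub hZ hψ hψ0 hψc hC0 hC ha T hε hδ
      obtain ⟨N, hN⟩ := hsmall η hη
      exact ⟨N, fun m hm n hn => h _ _ (hN m hm) (hN n hn)⟩
  refine ⟨Y, hYm, hYm.aemeasurable, fun ε hε δ hδ => ?_⟩
  have hδ' : 0 < ENNReal.ofReal δ / 2 := ENNReal.half_pos (ENNReal.ofReal_pos.2 hδ).ne'
  obtain ⟨η, hη, h⟩ := exists_mesh_riemannSum_sub hZ hψ hψ0 hψc hC0 hC ha T (half_pos hε) hδ'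
  refine ⟨η, hη, fun π₀ hπ₀ => ?_⟩
  obtain ⟨N, hN⟩ := hsmall η hη
  obtain ⟨n, hn, hnN⟩ := ((ENNReal.tendsto_nhds_zero.1 (hY (ε / 2) (half_pos hε)) _ hδ').and
    (eventually_ge_atTop N)).exists
  refine (measure_le_abs_sub_le_add _ (riemannSum (fun u => Real.exp (-a * u)) Z (π n)) _ ε).trans
    ?_
  rw [← ENNReal.add_halves (ENNReal.ofReal δ)]
  exact add_le_add (h _ _ hπ₀ (hN n hnN)) hn

/-- Existence of the improper integral `∫₀^∞ e^{-au} dZ(u)`. -/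
theorem exists_isImproperIntegral_exp :
    ∃ U : Ω → ℝ, IsImproperIntegral (fun u => Real.exp (-a * u)) Z P U := by
  choose Y hYm hY using exists_isIntegral_exp hZ hψ hψ0 hψc hC0 hC ha
  have hC' : ∀ ε : ℝ, 0 < ε → ∀ δ : ℝ≥0∞, 0 < δ → ∃ N : ℕ, ∀ T T' : ℝ≥0, N ≤ T → N ≤ T' →
      P {ω | ε ≤ |Y T ω - Y T' ω|} ≤ δ := by
    intro ε hε δ hδ
    by_cases htop : δ = ∞
    · exact ⟨0, fun _ _ _ _ => htop ▸ le_top⟩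
    have hδ2 : 0 < δ / 2 := ENNReal.half_pos hδ.ne'
    have hδ4 : 0 < δ / 2 / 2 := ENNReal.half_pos hδ2.ne'
    have hδ4t : δ / 2 / 2 ≠ ∞ :=
      ENNReal.div_ne_top (ENNReal.div_ne_top htop (by norm_num)) (by norm_num)
    set δ' : ℝ := (δ / 2 / 2).toReal
    have hof : ENNReal.ofReal δ' = δ / 2 / 2 := ENNReal.ofReal_toReal hδ4t
    have hδ'0 : 0 < δ' := ENNReal.toReal_pos hδ4.ne' hδ4t
    obtain ⟨η, hη, N, h⟩ := exists_mesh_riemannSum_sub_of_large hZ hψ hψ0 hψc hC0 hC ha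
      (half_pos (half_pos hε)) hδ4
    have happ : ∀ T, ∃ π : TaggedPartition T, π.MeshLE η ∧
        P {ω | ε / 2 / 2 ≤ |riemannSum (fun u => Real.exp (-a * u)) Z π ω - Y T ω|} ≤
          δ / 2 / 2 := by
      intro T
      obtain ⟨η', hη', hπ⟩ := (hY T).2 _ (half_pos (half_pos hε)) δ' hδ'0
      obtain ⟨π, hm⟩ := TaggedPartition.exists_meshLE T (lt_min hη hη')
      exact ⟨π, hm.mono (min_le_left _ _), hof ▸ hπ π (hm.mono (min_le_right _ _))⟩
    refine ⟨N, fun T T' hT hT' => ?_⟩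
    obtain ⟨π, hπ, h1⟩ := happ T
    obtain ⟨π', hπ', h2⟩ := happ T'
    have h3 := h T T' hT hT' π π' hπ hπ'
    have h4 : P {ω | ε / 2 ≤ |Y T ω - riemannSum (fun u => Real.exp (-a * u)) Z π ω|} ≤
        δ / 2 := by
      simp only [abs_sub_comm (Y T _)]
      refine (measure_mono ?_).trans (h1.trans ENNReal.half_le_self)
      exact fun ω (hω : ε / 2 ≤ _) => (half_le_self (half_pos hε).le).trans hω
    calc P {ω | ε ≤ |Y T ω - Y T' ω|}
        ≤ δ / 2 + (δ / 2 / 2 + δ / 2 / 2) := (measure_le_abs_sub_le_add _ _ _ ε).trans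
          (add_le_add h4 ((measure_le_abs_sub_le_add _ _ _ (ε / 2)).trans (add_le_add h3 h2)))
      _ = δ := by rw [ENNReal.add_halves, ENNReal.add_halves]
  obtain ⟨U, hUm, hU⟩ := exists_tendsto_measure_of_cauchy (fun n : ℕ => Y n) (fun n => hYm n)
    fun ε hε δ hδ => by
      obtain ⟨N, hN⟩ := hC' ε hε δ hδ
      exact ⟨N, fun m hm n hn => hN m n (Nat.cast_le.2 hm) (Nat.cast_le.2 hn)⟩
  refine ⟨U, hUm.aemeasurable, Y, hY, tendstoInMeasure_iff_norm.2 fun ε hε =>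
    ENNReal.tendsto_nhds_zero.2 fun δ hδ => ?_⟩
  have hδ2 : 0 < δ / 2 := ENNReal.half_pos hδ.ne'
  obtain ⟨N, hN⟩ := hC' (ε / 2) (half_pos hε) (δ / 2) hδ2
  obtain ⟨n, hn, hnN⟩ := ((ENNReal.tendsto_nhds_zero.1 (hU (ε / 2) (half_pos hε)) _ hδ2).and
    (eventually_ge_atTop N)).exists
  filter_upwards [eventually_ge_atTop (N : ℝ≥0)] with T hT
  refine (measure_le_abs_sub_le_add _ (Y n) _ ε).trans ?_
  rw [← ENNReal.add_halves δ]
  exact add_le_add (hN T n hT (Nat.cast_le.2 hnN)) hn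

/-- The characteristic function of `∫₀^∞ e^{-au} dZ(u)` is `exp (∫₀^∞ ψ(t e^{-au}) du)`. -/
theorem charFun_of_isImproperIntegral_exp {U : Ω → ℝ}
    (hU : IsImproperIntegral (fun u => Real.exp (-a * u)) Z P U) (t : ℝ) :
    charFun (P.map U) t =
      Complex.exp (∫ u in Set.Ioi (0 : ℝ), ψ (t * Real.exp (-a * u))) := by
  obtain ⟨hUm, Y, hY, hlim⟩ := hU
  -- a diagonal sequence: partitions of `[0, n]` whose sums approximate `Y n`
  have happ : ∀ n : ℕ, ∃ π : TaggedPartition (n : ℝ≥0), π.MeshLE (1 / ((n : ℝ) + 1)) ∧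
      P {ω | 1 / ((n : ℝ) + 1) ≤ |riemannSum (fun u => Real.exp (-a * u)) Z π ω - Y n ω|} ≤
        ENNReal.ofReal (1 / ((n : ℝ) + 1)) := by
    intro n
    have h0 : 0 < 1 / ((n : ℝ) + 1) := by positivity
    obtain ⟨η', hη', hπ⟩ := (hY n).2 _ h0 _ h0
    obtain ⟨π, hm⟩ := TaggedPartition.exists_meshLE (n : ℝ≥0) (lt_min h0 hη')
    exact ⟨π, hm.mono (min_le_left _ _), hπ π (hm.mono (min_le_right _ _))⟩
  choose π hπ hR using happ
  have hη : ∀ n : ℕ, 1 / ((n : ℝ) + 1) ≤ 1 := fun n =>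
    (div_le_one (by positivity)).2 (by linarith [n.cast_nonneg (α := ℝ)])
  have hcast : Tendsto (fun n : ℕ => (n : ℝ≥0)) atTop atTop := tendsto_natCast_atTop_atTop
  have hz := tendsto_one_div_add_atTop_nhds_zero_nat (𝕜 := ℝ)
  have hRU : TendstoInMeasure P (fun n => riemannSum (fun u => Real.exp (-a * u)) Z (π n))
      atTop U := by
    rw [tendstoInMeasure_iff_norm] at hlim ⊢
    intro ε hε
    have h1 : Tendsto (fun n : ℕ => P {ω | ε / 2 ≤
        |riemannSum (fun u => Real.exp (-a * u)) Z (π n) ω - Y n ω|}) atTop (𝓝 0) := by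
      have hz' := ENNReal.tendsto_ofReal hz
      rw [ENNReal.ofReal_zero] at hz'
      refine tendsto_of_tendsto_of_tendsto_of_le_of_le' tendsto_const_nhds hz'
        (Eventually.of_forall fun n => zero_le) ?_
      filter_upwards [hz.eventually_lt_const (half_pos hε)] with n hn
      refine (measure_mono ?_).trans (hR n)
      exact fun ω (hω : ε / 2 ≤ _) => hn.le.trans hω
    have h2 := (hlim (ε / 2) (half_pos hε)).comp hcast
    exact tendsto_of_tendsto_of_tendsto_of_le_of_le tendsto_const_nhds
      (by simpa using h1.add h2) (fun n => zero_le) fun n => measure_le_abs_sub_le_add _ _ _ ε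
  refine charFun_eq_of_tendstoInMeasure (fun n => measurable_riemannSum hZ.measurable _ _)
    hUm hRU ?_
  simp only [charFun_riemannSum hZ hψ hψ0]
  refine (Complex.continuous_exp.tendsto _).comp
    (tendsto_integral_exponent hψc hψ0 hC0 hC ha t (fun n => (π n).measurable_step _)
      (fun n x hx => (π n).step_of_notMem _ fun hm => absurd hm.1 (not_lt.2 hx))
      (fun n x => ?_) fun x hx => ?_)
  · obtain ⟨h1, h2⟩ := abs_step_exp_le (π n) ha (hπ n) (hη n) x
    rwa [abs_of_nonneg h1]
  · refine tendsto_step (f := fun u => Real.exp (-a * u)) (by fun_prop) π hπ ?_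
    obtain ⟨n₀, hn₀⟩ := exists_nat_ge x
    filter_upwards [eventually_ge_atTop n₀] with n hn
    exact ⟨hx, hn₀.trans (by simpa using hn)⟩

end Integral

end StPetersburg

theorem mainTheorem4 {Ω : Type*} [MeasurableSpace Ω] (P : Measure Ω) [IsProbabilityMeasure P]
    (p q r s a : ℝ) (hp0 : 0 < p) (hp1 : p < 1) (hq : q = 1 - p) (hr : r = 1 / q)
    (hs : 0 < s) (ha : 0 < a)
    (Z : ℝ≥0 → Ω → ℝ) (hZ : StPetersburg.IsLevyProcess Z P)
    (hZchar : ∀ (u : ℝ≥0) (t : ℝ),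
      charFun (P.map (Z u)) t = Complex.exp ((u : ℝ) * StPetersburg.exponentZ p q r s t)) :
    -- the integrals and the series in the definition of `g` converge
    (∀ (t : ℝ) (k : ℤ), IntervalIntegrable (StPetersburg.integrandU q t k) volume
      (s * r ^ (k - 1)) (s * r ^ k)) ∧
    (∀ t : ℝ, Summable (StPetersburg.termU q r s t)) ∧
    -- the integral `U = ∫₀^∞ e^{-au} dZ(u)` exists
    (∃ U : Ω → ℝ, StPetersburg.IsImproperIntegral (fun u => Real.exp (-a * u)) Z P U) ∧
    -- its characteristic function and its Lévy measure
    (∀ U : Ω → ℝ, StPetersburg.IsImproperIntegral (fun u => Real.exp (-a * u)) Z P U →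
      (∀ t : ℝ, charFun (P.map U) t = Complex.exp (StPetersburg.g q r s t / a)) ∧
      StPetersburg.HasLevyMeasure (P.map U) (StPetersburg.levyMeasureU q r s a)) ∧
    -- the Lévy measure of the exponent `g` itself
    StPetersburg.IsLevyExponent (StPetersburg.g q r s) (StPetersburg.levyMeasureU q r s 1) := by
  have hq0 : 0 < q := by linarith
  have hq1 : q < 1 := by linarith
  have hψc := StPetersburg.continuous_exponentZ hp0.le hq0 hq1 hr hs
  have hψ0 := StPetersburg.exponentZ_zero p q r s
  have hC := StPetersburg.norm_exponentZ_le hp0.le hq0 hq1 hr hs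
  have hC0 : 0 ≤ ∑' k, p * StPetersburg.weight q s k :=
    tsum_nonneg fun k => by unfold StPetersburg.weight; positivity
  refine ⟨StPetersburg.intervalIntegrable_integrandU hq0 hq1 hr hs,
    fun t => (StPetersburg.hasSum_termU hq0 hq1 hr hs hp0 hq ha t).summable,
    StPetersburg.exists_isImproperIntegral_exp hZ hZchar hψ0 hψc hC0 hC ha, fun U hU => ?_, ?_⟩
  · have hchar : ∀ t : ℝ, charFun (P.map U) t = Complex.exp (StPetersburg.g q r s t / a) :=
      fun t => by
        rw [StPetersburg.g_div_eq_integral hq0 hq1 hr hs hp0 hq ha]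
        exact StPetersburg.charFun_of_isImproperIntegral_exp hZ hZchar hψ0 hψc hC0 hC ha hU t
    exact ⟨hchar, _, StPetersburg.isLevyExponent_g_div hq0 hq1 hr hs ha, hchar⟩
  · simpa using StPetersburg.isLevyExponent_g_div hq0 hq1 hr hs one_pos
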